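/- Let $K$ be a field, let $\mathscr X$ be a (small) partially ordered set, regarded as a category with a unique morphism $x\to y$ whenever $x\le y$, and let $\mathcal C:\mathscr X\to Coalg$ be a functor to the category of (coassociative, counital) $K$-coalgebras. For a $K$-coalgebra $C$ let $\mathbf M_{[C,-]}$ be the category of right $C$-contramodules: vector spaces $M$ with a linear contraction $\pi:Hom_K(C,M)\to M$ that is contraunital and contraassociative with respect to $Hom_K(C,Hom_K(C,M))\cong Hom_K(C\otimes C,M)$, $g\mapsto (c\otimes c'\mapsto g(c)(c'))$. In particular $C^*=Hom_K(C,K)$ is the free $C$-contramodule on $K$. For a morphism $\alpha:C\to D$ of coalgebras let $\alpha_\bullet:\mathbf M_{[C,-]}\to\mathbf M_{[D,-]}$ be contrarestriction of scalars (same vector space, contraction $f\mapsto \pi(f\circ\alpha)$), and let $\alpha^\bullet:\mathbf M_{[D,-]}\to\mathbf M_{[C,-]}$, $\alpha^\bullet M=Cohom_D(C,M)$, be its left adjoint, the contraextension of scalars; here $Cohom_D(C,M)$ is the coequalizer of the two maps $Hom_K(C\otimes D,M)\cong Hom_K(C,Hom_K(D,M))\rightrightarrows Hom_K(C,M)$ induced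 by the right $D$-coaction on $C$ and by the contraction of $M$. Let $Cont^{tr}\text{-}\mathcal C$ be the category of right trans-contramodules over $\mathcal C$: an object $\mathcal M$ consists of a $\mathcal C_x$-contramodule $\mathcal M_x$ for each $x\in\mathscr X$ and a morphism ${}_\alpha\mathcal M:\mathcal M_y\to\alpha_\bullet\mathcal M_x$ of $\mathcal C_y$-contramodules for each $\alpha:x\to y$, with ${}_{id}\mathcal M=id$ and ${}_{\beta\alpha}\mathcal M=\beta_\bullet({}_\alpha\mathcal M)\circ{}_\beta\mathcal M$; a morphism is a family of contramodule morphisms $\mathcal M_x\to\mathcal N_x$ compatible with these structure maps. For $x\in\mathscr X$ let $ex_x:\mathbf M_{[\mathcal C_x,-]}\to Cont^{tr}\text{-}\mathcal C$ be the functor with $ex_x(N)_y=\alpha^\bullet N$ if there is a morphism $\alpha:y\to x$ and $ex_x(N)_y=0$ otherwise, with the canonical structure maps. Then $Cont^{tr}\text{-}\mathcal C$ is a locally presentable abelian category, and $\{ex_x(\mathcal C_x^*)\}_{x\in\mathscr X}$ is a set of projective generators of it (both in the sense that these objects jointly detect equality of parallel morphisms, and in the sense that for every non-invertible monomorphism $\mathcal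 N\to\mathcal M$ some morphism $ex_x(\mathcal C_x^*)\to\mathcal M$ does not factor through it). Moreover, there is a regular cardinal $\lambda_0$ such that $\mathcal C_x^*$ is $\lambda_0$-presentable in $\mathbf M_{[\mathcal C_x,-]}$ for every $x\in\mathscr X$; and for every such $\lambda_0$, each $ex_x(\mathcal C_x^*)$ is $\lambda_0$-presentable in $Cont^{tr}\text{-}\mathcal C$ and the category $Cont^{tr}\text{-}\mathcal C$ is locally $\lambda_0$-presentable. -/

import Mathlib

open CategoryTheory
open scoped TensorProduct

universe u

/-- A right contramodule over the `K`-coalgebra `C`: a `K`-vector space `M` with a linear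
contraction `π : Hom_K(C, M) → M` which is contraunital and contraassociative. In `contra_assoc`,
the identification `Hom_K(C, Hom_K(C, M)) ≅ Hom_K(C ⊗ C, M)` is `g ↦ (c ⊗ c' ↦ g c c')`, that is,
the adjunction between `- ⊗ C` and `Hom_K(C, -)`. -/
structure Contramodule (K : Type u) [Field K] (C : Type u) [AddCommGroup C] [Module K C]
    [Coalgebra K C] : Type (u + 1) where
  carrier : Type u
  [instAddCommGroup : AddCommGroup carrier]
  [instModule : Module K carrier]
  π : (C →ₗ[K] carrier) →ₗ[K] carrier
  contra_counit : ∀ m : carrier,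
    π (LinearMap.toSpanSingleton K carrier m ∘ₗ Coalgebra.counit) = m
  contra_assoc : ∀ g : C →ₗ[K] C →ₗ[K] carrier,
    π (π ∘ₗ g) = π (TensorProduct.lift g ∘ₗ Coalgebra.comul)

attribute [instance] Contramodule.instAddCommGroup Contramodule.instModule

namespace Contramodule

section Basic

variable {K : Type u} [Field K] {C : Type u} [AddCommGroup C] [Module K C] [Coalgebra K C]

/-- Morphisms of contramodules: linear maps commuting with the contractions. -/
@[ext]
structure Hom (M N : Contramodule K C) : Type u where
  lin : M.carrier →ₗ[K] N.carrier
  comm : ∀ f : C →ₗ[K] M.carrier, lin (M.π f) = N.π (lin ∘ₗ f)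

/-- The category of right `C`-contramodules. -/
instance : Category.{u} (Contramodule K C) where
  Hom M N := Hom M N
  id M := { lin := LinearMap.id, comm := fun f => by simp }
  comp {M N P} f g :=
    { lin := g.lin ∘ₗ f.lin
      comm := fun h => by
        rw [LinearMap.comp_apply, f.comm, g.comm, LinearMap.comp_assoc] }

@[ext]
theorem hom_ext {M N : Contramodule K C} {f g : M ⟶ N} (h : f.lin = g.lin) : f = g :=
  Hom.ext h

@[simp] theorem id_lin (M : Contramodule K C) : Hom.lin (𝟙 M) = LinearMap.id := rfl

@[simp] theorem comp_lin {M N P : Contramodule K C} (f : M ⟶ N) (g : N ⟶ P) :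
    (f ≫ g).lin = g.lin ∘ₗ f.lin := rfl

end Basic

section Free

variable {K : Type u} [Field K] {C : Type u} [AddCommGroup C] [Module K C] [Coalgebra K C]
variable {V : Type u} [AddCommGroup V] [Module K V]

variable (C V) in
/-- The linear map `Hom_K(C, Hom_K(C, V)) ≅ Hom_K(C ⊗ C, V) → Hom_K(C, V)`, where the last map is
composition with the comultiplication. -/
noncomputable def freeπ : (C →ₗ[K] C →ₗ[K] V) →ₗ[K] (C →ₗ[K] V) :=
  LinearMap.lcomp K V Coalgebra.comul ∘ₗ TensorProduct.uncurry (.id K) C C V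

theorem freeπ_eq (g : C →ₗ[K] C →ₗ[K] V) :
    freeπ C V g = TensorProduct.lift g ∘ₗ Coalgebra.comul := rfl

theorem freeπ_assoc (h : C →ₗ[K] C →ₗ[K] C →ₗ[K] V) :
    freeπ C V (freeπ C V ∘ₗ h) = freeπ C V (freeπ C (C →ₗ[K] V) h) := by
  have key : TensorProduct.lift (freeπ C V ∘ₗ h) =
      TensorProduct.lift (TensorProduct.uncurry (.id K) C C V ∘ₗ h) ∘ₗ
        LinearMap.lTensor C Coalgebra.comul := by
    ext a b
    simp only [TensorProduct.AlgebraTensorModule.curry_apply, LinearMap.restrictScalars_self,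
      TensorProduct.curry_apply, TensorProduct.lift.tmul, LinearMap.comp_apply, freeπ_eq,
      LinearMap.lTensor_tmul]
    rfl
  have key2 : TensorProduct.lift (freeπ C (C →ₗ[K] V) h) =
      TensorProduct.lift (TensorProduct.lift h) ∘ₗ LinearMap.rTensor C Coalgebra.comul := by
    ext a b
    simp [freeπ_eq]
  have key3 : TensorProduct.lift (TensorProduct.lift h) =
      TensorProduct.lift (TensorProduct.uncurry (.id K) C C V ∘ₗ h) ∘ₗ
        (TensorProduct.assoc K C C C).toLinearMap := by
    ext a b c
    simp
  ext c
  rw [freeπ_eq, freeπ_eq, key, key2, key3]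
  simp only [LinearMap.comp_apply, LinearEquiv.coe_coe, Coalgebra.coassoc_apply]

variable (K C V) in
/-- The free contramodule `T_C(V) = Hom_K(C, V)`. -/
noncomputable def free : Contramodule K C where
  carrier := C →ₗ[K] V
  π := freeπ C V
  contra_counit m := by
    ext c
    have key : TensorProduct.lift
        (LinearMap.toSpanSingleton K (C →ₗ[K] V) m ∘ₗ
          (Coalgebra.counit (R := K) (A := C))) =
        TensorProduct.lift ((LinearMap.lsmul K V).compl₂ m) ∘ₗ
          LinearMap.rTensor C Coalgebra.counit := by
      ext a b
      simp
    rw [freeπ_eq, key]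
    simp
  contra_assoc h := freeπ_assoc h

variable (K C) in
/-- The contramodule `C^* = Hom_K(C, K) = T_C(K)`. -/
noncomputable def dual : Contramodule K C := free K C K

end Free

section Quotient

variable {K : Type u} [Field K] {C : Type u} [AddCommGroup C] [Module K C] [Coalgebra K C]

theorem exists_section {V : Type u} [AddCommGroup V] [Module K V] (R : Submodule K V) :
    ∃ s : (V ⧸ R) →ₗ[K] V, R.mkQ ∘ₗ s = LinearMap.id :=
  R.mkQ.exists_rightInverse_of_surjective R.range_mkQ

/-- The contraction on the quotient of `P` by a subcontramodule `R`: lift `C → P / R` to a map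
`C → P`, contract, and project. The result does not depend on the lift
(see `quotientπ_mkQ_comp`). -/
noncomputable def quotientπ (P : Contramodule K C) (R : Submodule K P.carrier) :
    (C →ₗ[K] (P.carrier ⧸ R)) →ₗ[K] (P.carrier ⧸ R) :=
  R.mkQ ∘ₗ P.π ∘ₗ LinearMap.compRight K (exists_section R).choose

theorem quotientπ_mkQ_comp (P : Contramodule K C) (R : Submodule K P.carrier)
    (hR : ∀ f : C →ₗ[K] P.carrier, (∀ c, f c ∈ R) → P.π f ∈ R) (f : C →ₗ[K] P.carrier) :
    quotientπ P R (R.mkQ ∘ₗ f) = R.mkQ (P.π f) := by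
  have hs := (exists_section R).choose_spec
  set s := (exists_section R).choose with hsdef
  change R.mkQ (P.π (s ∘ₗ R.mkQ ∘ₗ f)) = R.mkQ (P.π f)
  rw [← sub_eq_zero, ← map_sub, ← map_sub, Submodule.mkQ_apply, Submodule.Quotient.mk_eq_zero]
  apply hR
  intro c
  rw [← Submodule.Quotient.mk_eq_zero, ← Submodule.mkQ_apply, LinearMap.sub_apply, map_sub,
    sub_eq_zero]
  exact LinearMap.congr_fun hs (R.mkQ (f c))

theorem exists_lift {V : Type u} [AddCommGroup V] [Module K V] (R : Submodule K V)
    {W : Type u} [AddCommGroup W] [Module K W] (f : W →ₗ[K] (V ⧸ R)) :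
    ∃ g : W →ₗ[K] V, R.mkQ ∘ₗ g = f := by
  obtain ⟨s, hs⟩ := exists_section R
  exact ⟨s ∘ₗ f, by rw [← LinearMap.comp_assoc, hs, LinearMap.id_comp]⟩

/-- The quotient of the contramodule `P` by a subcontramodule `R`. -/
noncomputable def quotient (P : Contramodule K C) (R : Submodule K P.carrier)
    (hR : ∀ f : C →ₗ[K] P.carrier, (∀ c, f c ∈ R) → P.π f ∈ R) : Contramodule K C where
  carrier := P.carrier ⧸ R
  π := quotientπ P R
  contra_counit m := by
    obtain ⟨p, rfl⟩ := R.mkQ_surjective m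
    have : LinearMap.toSpanSingleton K (P.carrier ⧸ R) (R.mkQ p) ∘ₗ Coalgebra.counit =
        R.mkQ ∘ₗ LinearMap.toSpanSingleton K P.carrier p ∘ₗ
          (Coalgebra.counit (R := K) (A := C)) := by
      ext c
      simp
    rw [this, quotientπ_mkQ_comp P R hR, P.contra_counit]
  contra_assoc g := by
    have hs := (exists_section R).choose_spec
    set s := (exists_section R).choose with hsdef
    have hg : g = LinearMap.compRight K R.mkQ ∘ₗ (LinearMap.compRight K s ∘ₗ g) := by
      ext c c'
      exact (LinearMap.congr_fun hs (g c c')).symm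
    set g' : C →ₗ[K] C →ₗ[K] P.carrier := LinearMap.compRight K s ∘ₗ g with hg'
    have h1 : quotientπ P R ∘ₗ g = R.mkQ ∘ₗ P.π ∘ₗ g' := rfl
    have h2 : TensorProduct.lift g = R.mkQ ∘ₗ TensorProduct.lift g' := by
      rw [hg]
      ext a b
      simp
    rw [h1, h2, LinearMap.comp_assoc, quotientπ_mkQ_comp P R hR, quotientπ_mkQ_comp P R hR,
      P.contra_assoc]

end Quotient

section Scalars

variable {K : Type u} [Field K]
variable {C : Type u} [AddCommGroup C] [Module K C] [Coalgebra K C]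
variable {D : Type u} [AddCommGroup D] [Module K D] [Coalgebra K D]

/-- The contrarestriction of scalars `α_•` along a morphism of coalgebras `α : C → D`. -/
def contrarestriction (α : C →ₗc[K] D) : Contramodule K C ⥤ Contramodule K D where
  obj M :=
    { carrier := M.carrier
      π := M.π ∘ₗ LinearMap.lcomp K M.carrier α.toLinearMap
      contra_counit := fun m => by
        have : (LinearMap.toSpanSingleton K M.carrier m ∘ₗ
            (Coalgebra.counit (R := K) (A := D))) ∘ₗ α.toLinearMap =
            LinearMap.toSpanSingleton K M.carrier m ∘ₗ Coalgebra.counit := by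
          rw [LinearMap.comp_assoc, α.counit_comp]
        exact (congrArg M.π this).trans (M.contra_counit m)
      contra_assoc := fun g => by
        have h := M.contra_assoc (LinearMap.lcomp K M.carrier α.toLinearMap ∘ₗ g ∘ₗ α.toLinearMap)
        have h2 : TensorProduct.lift
              (LinearMap.lcomp K M.carrier α.toLinearMap ∘ₗ g ∘ₗ α.toLinearMap) ∘ₗ
              Coalgebra.comul =
            (TensorProduct.lift g ∘ₗ Coalgebra.comul) ∘ₗ α.toLinearMap := by
          rw [LinearMap.comp_assoc, ← α.map_comp_comul, ← LinearMap.comp_assoc (Coalgebra.comul (R := K) (A := C))]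
          refine congrArg (fun t : C ⊗[K] C →ₗ[K] M.carrier => t ∘ₗ Coalgebra.comul) ?_
          ext a b
          simp
        rw [h2] at h
        exact h }
  map f :=
    { lin := f.lin
      comm := fun h => f.comm (h ∘ₗ α.toLinearMap) }

/-- The right `D`-coaction `C → C ⊗ D` on `C` induced by a morphism of coalgebras `α : C → D`. -/
noncomputable def rightCoaction (α : C →ₗc[K] D) : C →ₗ[K] C ⊗[K] D :=
  LinearMap.lTensor C α.toLinearMap ∘ₗ Coalgebra.comul

/-- The difference of the two maps `Hom_K(C ⊗ D, M) ≅ Hom_K(C, Hom_K(D, M)) ⇉ Hom_K(C, M)`, one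
induced by the contraction of `M` and the other by the right `D`-coaction on `C`. -/
noncomputable def cohomRel (α : C →ₗc[K] D) (M : Contramodule K D) :
    (C →ₗ[K] D →ₗ[K] M.carrier) →ₗ[K] (C →ₗ[K] M.carrier) :=
  LinearMap.compRight K M.π -
    LinearMap.lcomp K M.carrier (rightCoaction α) ∘ₗ
      TensorProduct.uncurry (.id K) C D M.carrier

theorem cohomRel_apply (α : C →ₗc[K] D) (M : Contramodule K D)
    (g : C →ₗ[K] D →ₗ[K] M.carrier) :
    cohomRel α M g = M.π ∘ₗ g - TensorProduct.lift g ∘ₗ rightCoaction α := rfl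

theorem lift_comp_rightCoaction (α : C →ₗc[K] D) {V : Type u} [AddCommGroup V] [Module K V]
    (g : C →ₗ[K] D →ₗ[K] V) :
    TensorProduct.lift g ∘ₗ rightCoaction α =
      freeπ C V (LinearMap.lcomp K V α.toLinearMap ∘ₗ g) := by
  rw [freeπ_eq, rightCoaction, ← LinearMap.comp_assoc]
  congr 1
  ext a b
  simp

theorem freeπ_cohomRel_comp (α : C →ₗc[K] D) (M : Contramodule K D)
    (h : C →ₗ[K] C →ₗ[K] D →ₗ[K] M.carrier) :
    freeπ C M.carrier (cohomRel α M ∘ₗ h) =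
      cohomRel α M (freeπ C (D →ₗ[K] M.carrier) h) := by
  have h1 : cohomRel α M ∘ₗ h = LinearMap.compRight K M.π ∘ₗ h -
      freeπ C M.carrier ∘ₗ
        (LinearMap.compRight K (LinearMap.lcomp K M.carrier α.toLinearMap) ∘ₗ h) := by
    refine LinearMap.ext fun c => ?_
    change cohomRel α M (h c) = _
    rw [cohomRel_apply, lift_comp_rightCoaction]
    rfl
  have h2 : freeπ C M.carrier (LinearMap.compRight K M.π ∘ₗ h) =
      M.π ∘ₗ freeπ C (D →ₗ[K] M.carrier) h := by
    rw [freeπ_eq, freeπ_eq, ← LinearMap.comp_assoc]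
    congr 1
    ext a b
    simp
  have h3 : freeπ C (C →ₗ[K] M.carrier)
        (LinearMap.compRight K (LinearMap.lcomp K M.carrier α.toLinearMap) ∘ₗ h) =
      LinearMap.lcomp K M.carrier α.toLinearMap ∘ₗ freeπ C (D →ₗ[K] M.carrier) h := by
    rw [freeπ_eq, freeπ_eq, ← LinearMap.comp_assoc]
    congr 1
    ext a b
    simp
  rw [h1, map_sub, freeπ_assoc, h2, h3, cohomRel_apply, lift_comp_rightCoaction]

theorem range_cohomRel_closed (α : C →ₗc[K] D) (M : Contramodule K D)
    (f : C →ₗ[K] (free K C M.carrier).carrier)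
    (hf : ∀ c, f c ∈ LinearMap.range (cohomRel α M)) :
    (free K C M.carrier).π f ∈ LinearMap.range (cohomRel α M) := by
  obtain ⟨t, ht⟩ := (cohomRel α M).rangeRestrict.exists_rightInverse_of_surjective
    (LinearMap.range_rangeRestrict _)
  let f' : C →ₗ[K] LinearMap.range (cohomRel α M) := LinearMap.codRestrict _ f hf
  have h : f = cohomRel α M ∘ₗ (t ∘ₗ f') := by
    ext1 c
    have := congrArg Subtype.val (LinearMap.congr_fun ht (f' c))
    exact this.symm
  rw [h]
  exact ⟨_, (freeπ_cohomRel_comp α M (t ∘ₗ f')).symm⟩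

/-- The contraextension of scalars `α^• M = Cohom_D(C, M)` along `α : C → D`, on objects: the
coequalizer of `Hom_K(C ⊗ D, M) ⇉ Hom_K(C, M)`, with the `C`-contramodule structure induced by the
left `C`-comodule structure of `C`, i.e. as a quotient of the free contramodule
`T_C(M) = Hom_K(C, M)`. -/
noncomputable def contraextensionObj (α : C →ₗc[K] D) (M : Contramodule K D) :
    Contramodule K C :=
  (free K C M.carrier).quotient (LinearMap.range (cohomRel α M)) (range_cohomRel_closed α M)

theorem contraextensionObj_π_mkQ (α : C →ₗc[K] D) (M : Contramodule K D)
    (f : C →ₗ[K] C →ₗ[K] M.carrier) :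
    (contraextensionObj α M).π ((LinearMap.range (cohomRel α M)).mkQ ∘ₗ f) =
      (LinearMap.range (cohomRel α M)).mkQ (freeπ C M.carrier f) :=
  quotientπ_mkQ_comp (free K C M.carrier) _ (range_cohomRel_closed α M) f

theorem cohomRel_le_comap_compRight (α : C →ₗc[K] D) {M N : Contramodule K D} (u : M ⟶ N) :
    LinearMap.range (cohomRel α M) ≤
      (LinearMap.range (cohomRel α N)).comap (LinearMap.compRight K u.lin) := by
  rintro _ ⟨g, rfl⟩
  refine ⟨LinearMap.compRight K u.lin ∘ₗ g, ?_⟩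
  rw [cohomRel_apply, cohomRel_apply, map_sub]
  congr 1
  · refine LinearMap.ext fun c => ?_
    exact (u.comm (g c)).symm
  · change _ = u.lin ∘ₗ TensorProduct.lift g ∘ₗ rightCoaction α
    rw [← LinearMap.comp_assoc]
    congr 1
    ext a b
    simp

/-- The contraextension of scalars `α^•` on morphisms, induced by composition with `u`. -/
noncomputable def contraextensionMap (α : C →ₗc[K] D) {M N : Contramodule K D} (u : M ⟶ N) :
    contraextensionObj α M ⟶ contraextensionObj α N where
  lin := Submodule.mapQ (LinearMap.range (cohomRel α M)) (LinearMap.range (cohomRel α N))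
    (LinearMap.compRight K u.lin) (cohomRel_le_comap_compRight α u)
  comm f := by
    obtain ⟨f, rfl⟩ := exists_lift (V := C →ₗ[K] M.carrier) _ f
    refine (congrArg _ (contraextensionObj_π_mkQ α M f)).trans ?_
    refine Eq.trans ?_ (contraextensionObj_π_mkQ α N (LinearMap.compRight K u.lin ∘ₗ f)).symm
    refine congrArg (LinearMap.range (cohomRel α N)).mkQ ?_
    change u.lin ∘ₗ TensorProduct.lift f ∘ₗ Coalgebra.comul = _
    rw [freeπ_eq, ← LinearMap.comp_assoc]
    refine congrArg (fun t : C ⊗[K] C →ₗ[K] N.carrier => t ∘ₗ Coalgebra.comul) ?_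
    ext a b
    rfl

/-- The contraextension of scalars `α^•` along a morphism of coalgebras `α : C → D`. -/
noncomputable def contraextension (α : C →ₗc[K] D) : Contramodule K D ⥤ Contramodule K C where
  obj M := contraextensionObj α M
  map u := contraextensionMap α u
  map_id M := by
    apply hom_ext
    apply Submodule.linearMap_qext
    ext
    rfl
  map_comp u v := by
    apply hom_ext
    apply Submodule.linearMap_qext
    ext
    rfl

variable {B : Type u} [AddCommGroup B] [Module K B] [Coalgebra K B]

theorem cohomRel_le_comap_lcomp (α : C →ₗc[K] D) (β : B →ₗc[K] C) (α' : B →ₗc[K] D)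
    (h : α.comp β = α') (N : Contramodule K D) :
    LinearMap.range (cohomRel α N) ≤
      (LinearMap.range (cohomRel α' N)).comap (LinearMap.lcomp K N.carrier β.toLinearMap) := by
  subst h
  rintro _ ⟨g, rfl⟩
  refine ⟨g ∘ₗ β.toLinearMap, ?_⟩
  rw [cohomRel_apply, cohomRel_apply, map_sub]
  congr 1
  change _ = (TensorProduct.lift g ∘ₗ LinearMap.lTensor C α.toLinearMap ∘ₗ
    Coalgebra.comul) ∘ₗ β.toLinearMap
  rw [LinearMap.comp_assoc, LinearMap.comp_assoc, ← β.map_comp_comul, rightCoaction,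
    ← LinearMap.comp_assoc, ← LinearMap.comp_assoc, ← LinearMap.comp_assoc]
  congr 1
  ext a b
  simp

/-- For morphisms of coalgebras `β : B → C`, `α : C → D` with composite `α'`, the canonical morphism
`α^• N → β_• (α'^• N)` of `C`-contramodules, induced by
`- ∘ β : Hom_K(C, N) → Hom_K(B, N)`. It corresponds by adjunction to the canonical isomorphism
`β^• α^• N ≅ α'^• N`. -/
noncomputable def contraextensionTransition (α : C →ₗc[K] D) (β : B →ₗc[K] C) (α' : B →ₗc[K] D)
    (h : α.comp β = α') (N : Contramodule K D) :
    (contraextension α).obj N ⟶ (contrarestriction β).obj ((contraextension α').obj N) where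
  lin := Submodule.mapQ (LinearMap.range (cohomRel α N)) (LinearMap.range (cohomRel α' N))
    (LinearMap.lcomp K N.carrier β.toLinearMap) (cohomRel_le_comap_lcomp α β α' h N)
  comm f := by
    obtain ⟨f, rfl⟩ := exists_lift (V := C →ₗ[K] N.carrier) _ f
    refine (congrArg _ (contraextensionObj_π_mkQ α N f)).trans ?_
    refine Eq.trans ?_ (contraextensionObj_π_mkQ α' N
      (LinearMap.lcomp K N.carrier β.toLinearMap ∘ₗ f ∘ₗ β.toLinearMap)).symm
    refine congrArg (LinearMap.range (cohomRel α' N)).mkQ ?_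
    change (TensorProduct.lift f ∘ₗ Coalgebra.comul) ∘ₗ β.toLinearMap = _
    rw [freeπ_eq, LinearMap.comp_assoc, ← β.map_comp_comul, ← LinearMap.comp_assoc]
    refine congrArg (fun t : B ⊗[K] B →ₗ[K] N.carrier => t ∘ₗ Coalgebra.comul) ?_
    ext a b
    rfl

theorem contraextensionTransition_id (α : C →ₗc[K] D) (β : C →ₗc[K] C) (h : α.comp β = α)
    (hβ : β.toLinearMap = LinearMap.id) (N : Contramodule K D) (m : (contraextensionObj α N).carrier) :
    (contraextensionTransition α β α h N).lin m = m := by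
  obtain ⟨f, rfl⟩ := Submodule.mkQ_surjective _ m
  refine congrArg (Submodule.mkQ _) ?_
  change f ∘ₗ β.toLinearMap = f
  rw [hβ]
  rfl

theorem contraextensionTransition_comp {A : Type u} [AddCommGroup A] [Module K A] [Coalgebra K A]
    (α : C →ₗc[K] D) (β : B →ₗc[K] C) (α' : B →ₗc[K] D) (h : α.comp β = α')
    (γ : A →ₗc[K] B) (α'' : A →ₗc[K] D) (h' : α'.comp γ = α'')
    (δ : A →ₗc[K] C) (h'' : α.comp δ = α'') (hδ : δ.toLinearMap = β.toLinearMap ∘ₗ γ.toLinearMap)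
    (N : Contramodule K D) (m : (contraextensionObj α N).carrier) :
    (contraextensionTransition α δ α'' h'' N).lin m =
      (contraextensionTransition α' γ α'' h' N).lin
        ((contraextensionTransition α β α' h N).lin m) := by
  obtain ⟨f, rfl⟩ := Submodule.mkQ_surjective _ m
  refine congrArg (Submodule.mkQ _) ?_
  change f ∘ₗ δ.toLinearMap = (f ∘ₗ β.toLinearMap) ∘ₗ γ.toLinearMap
  rw [hδ]
  rfl

theorem contraextensionTransition_naturality (α : C →ₗc[K] D) (β : B →ₗc[K] C)
    (α' : B →ₗc[K] D) (h : α.comp β = α') {N N' : Contramodule K D} (u : N ⟶ N')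
    (m : (contraextensionObj α N).carrier) :
    ((contraextension α').map u).lin ((contraextensionTransition α β α' h N).lin m) =
      (contraextensionTransition α β α' h N').lin (((contraextension α).map u).lin m) := by
  obtain ⟨f, rfl⟩ := Submodule.mkQ_surjective _ m
  rfl

end Scalars

section Pi

variable {K : Type u} [Field K] {C : Type u} [AddCommGroup C] [Module K C] [Coalgebra K C]

/-- The product of a family of contramodules. -/
def pi {ι : Type u} (M : ι → Contramodule K C) : Contramodule K C where
  carrier := ∀ i, (M i).carrier
  π := LinearMap.pi fun i => (M i).π ∘ₗ LinearMap.compRight K (LinearMap.proj i)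
  contra_counit m := by
    funext i
    refine Eq.trans ?_ ((M i).contra_counit (m i))
    exact congrArg (M i).π (LinearMap.ext fun c => rfl)
  contra_assoc g := by
    funext i
    let p : (∀ i, (M i).carrier) →ₗ[K] (M i).carrier := LinearMap.proj i
    have key : TensorProduct.lift (LinearMap.compRight K p ∘ₗ g) = p ∘ₗ TensorProduct.lift g := by
      ext a b
      simp
    have h := (M i).contra_assoc (LinearMap.compRight K p ∘ₗ g)
    rw [key] at h
    exact h

/-- The projections from a product of contramodules. -/
def proj {ι : Type u} (M : ι → Contramodule K C) (i : ι) : pi M ⟶ M i where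
  lin := LinearMap.proj i
  comm _ := rfl

/-- The zero morphism. -/
def zeroHom (M N : Contramodule K C) : M ⟶ N where
  lin := 0
  comm f := by simp

end Pi

end Contramodule

/-- A right trans-contramodule over a coalgebra representation `𝒞 : X ⥤ Coalg`. -/
structure TransContramodule {K : Type u} [Field K] {X : Type u} [SmallCategory X]
    (𝒞 : X ⥤ CoalgCat.{u} K) : Type (u + 1) where
  obj (x : X) : Contramodule K (𝒞.obj x)
  map {x y : X} (α : x ⟶ y) :
    obj y ⟶ (Contramodule.contrarestriction (𝒞.map α).toCoalgHom).obj (obj x)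
  map_id (x : X) (m : (obj x).carrier) : (map (𝟙 x)).lin m = m
  map_comp {x y z : X} (α : x ⟶ y) (β : y ⟶ z) (m : (obj z).carrier) :
    (map (α ≫ β)).lin m = (map α).lin ((map β).lin m)

namespace TransContramodule

section

variable {K : Type u} [Field K] {X : Type u} [SmallCategory X] {𝒞 : X ⥤ CoalgCat.{u} K}

/-- Morphisms of trans-contramodules. -/
@[ext]
structure Hom (M N : TransContramodule 𝒞) : Type u where
  app (x : X) : M.obj x ⟶ N.obj x
  naturality {x y : X} (α : x ⟶ y) :
    M.map α ≫ (Contramodule.contrarestriction (𝒞.map α).toCoalgHom).map (app x) =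
      app y ≫ N.map α

/-- The category of right trans-contramodules over `𝒞`. -/
instance : Category.{u} (TransContramodule 𝒞) where
  Hom M N := Hom M N
  id M := { app := fun x => 𝟙 (M.obj x), naturality := fun α => by simp }
  comp f g :=
    { app := fun x => f.app x ≫ g.app x
      naturality := fun α => by
        rw [Functor.map_comp, ← Category.assoc, f.naturality, Category.assoc, g.naturality,
          Category.assoc] }

end

section Extension

variable {K : Type u} [Field K] {X : Type u} [PartialOrder X] (𝒞 : X ⥤ CoalgCat.{u} K) (x : X)
  (N : Contramodule K (𝒞.obj x))

/-- The value at `y` of `ex_x(N)`, for a representation of a poset `X`: the product of the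
contramodules `α^• N` over `α ∈ X(y, x)`. Since `X` is a poset, this is `α^• N` if `y ≤ x`, with
`α : y → x` the unique morphism (see `proj_bijective`), and `0` otherwise
(see `exValue_subsingleton`). -/
noncomputable def exValue (y : X) : Contramodule K (𝒞.obj y) :=
  Contramodule.pi fun α : y ⟶ x => (Contramodule.contraextension (𝒞.map α).toCoalgHom).obj N

theorem proj_bijective {y : X} (α : y ⟶ x) :
    Function.Bijective (Contramodule.proj (fun α : y ⟶ x =>
      (Contramodule.contraextension (𝒞.map α).toCoalgHom).obj N) α).lin := by
  constructor
  · intro m n h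
    funext β
    obtain rfl : β = α := Subsingleton.elim _ _
    exact h
  · intro n
    refine ⟨fun β => (Subsingleton.elim α β) ▸ n, rfl⟩

theorem exValue_subsingleton {y : X} (h : ¬ y ≤ x) : Subsingleton (exValue 𝒞 x N y).carrier :=
  ⟨fun _ _ => funext fun α => absurd (leOfHom α) h⟩

theorem exComponent_comp_eq {z y : X} (β : z ⟶ y) (γ : z ⟶ x) (α : y ⟶ x) :
    (𝒞.map α).toCoalgHom.comp (𝒞.map β).toCoalgHom = (𝒞.map γ).toCoalgHom := by
  rw [← CoalgCat.toCoalgHom_comp, ← Functor.map_comp]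
  congr 1

open Classical in
/-- The components of the structure morphisms of `ex_x(N)`: for `β : z → y` and `γ : z → x`, the
canonical map `α^• N → β_• (γ^• N)` if there is `α : y → x` (so that `γ = αβ`), and `0`
otherwise. -/
noncomputable def exComponent {z y : X} (β : z ⟶ y) (γ : z ⟶ x) :
    exValue 𝒞 x N y ⟶ (Contramodule.contrarestriction (𝒞.map β).toCoalgHom).obj
      ((Contramodule.contraextension (𝒞.map γ).toCoalgHom).obj N) :=
  if h : y ≤ x then
    Contramodule.proj _ (homOfLE h) ≫
      Contramodule.contraextensionTransition (𝒞.map (homOfLE h)).toCoalgHom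
        (𝒞.map β).toCoalgHom (𝒞.map γ).toCoalgHom
        (exComponent_comp_eq 𝒞 x β γ (homOfLE h)) N
  else Contramodule.zeroHom _ _

theorem exComponent_lin {z y : X} (β : z ⟶ y) (γ : z ⟶ x) (α : y ⟶ x)
    (m : (exValue 𝒞 x N y).carrier) :
    (exComponent 𝒞 x N β γ).lin m =
      (Contramodule.contraextensionTransition (𝒞.map α).toCoalgHom (𝒞.map β).toCoalgHom
        (𝒞.map γ).toCoalgHom (exComponent_comp_eq 𝒞 x β γ α) N).lin (m α) := by
  have h : y ≤ x := leOfHom α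
  obtain rfl : homOfLE h = α := Subsingleton.elim _ _
  have e : exComponent 𝒞 x N β γ = _ := dif_pos h
  rw [e]
  rfl

/-- The functor `ex_x` on objects, for a representation of a poset `X`. -/
noncomputable def exObj : TransContramodule 𝒞 where
  obj y := exValue 𝒞 x N y
  map {z y} β :=
    { lin := LinearMap.pi fun γ : z ⟶ x => (exComponent 𝒞 x N β γ).lin
      comm := fun f => funext fun γ => (exComponent 𝒞 x N β γ).comm f }
  map_id y m := by
    funext γ
    refine (exComponent_lin 𝒞 x N (𝟙 y) γ γ m).trans ?_
    refine Contramodule.contraextensionTransition_id _ _ _ ?_ N (m γ)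
    rw [CategoryTheory.Functor.map_id]
    rfl
  map_comp {w z y} β γ m := by
    funext δ
    change (exComponent 𝒞 x N (β ≫ γ) δ).lin m = (exComponent 𝒞 x N β δ).lin
      (fun ε => (exComponent 𝒞 x N γ ε).lin m)
    by_cases h : y ≤ x
    · refine (exComponent_lin 𝒞 x N (β ≫ γ) δ (homOfLE h) m).trans (Eq.trans ?_
        (exComponent_lin 𝒞 x N β δ (γ ≫ homOfLE h)
          (fun ε => (exComponent 𝒞 x N γ ε).lin m)).symm)
      refine Eq.trans ?_ (congrArg _
        (exComponent_lin 𝒞 x N γ (γ ≫ homOfLE h) (homOfLE h) m).symm)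
      refine Contramodule.contraextensionTransition_comp _ _ _ _ _ _ _ _ _ ?_ N _
      rw [CategoryTheory.Functor.map_comp]
      rfl
    · have h0 : m = 0 := @Subsingleton.elim _ (exValue_subsingleton 𝒞 x N h) _ _
      subst h0
      have h1 : (fun ε : z ⟶ x => (exComponent 𝒞 x N γ ε).lin (0 : (exValue 𝒞 x N y).carrier)) =
          (0 : (exValue 𝒞 x N z).carrier) := funext fun ε => map_zero _
      refine (map_zero _).trans ?_
      exact ((congrArg (exComponent 𝒞 x N β δ).lin h1).trans (map_zero _)).symm

/-- The functor `ex_x` on morphisms. -/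
noncomputable def exMap {N N' : Contramodule K (𝒞.obj x)} (u : N ⟶ N') :
    exObj 𝒞 x N ⟶ exObj 𝒞 x N' where
  app y :=
    { lin := LinearMap.pi fun α : y ⟶ x =>
        (Contramodule.proj _ α ≫
          (Contramodule.contraextension (𝒞.map α).toCoalgHom).map u).lin
      comm := fun f => funext fun α => (Contramodule.proj _ α ≫
        (Contramodule.contraextension (𝒞.map α).toCoalgHom).map u).comm f }
  naturality {z y} β := by
    apply Contramodule.hom_ext
    refine LinearMap.ext fun m => funext fun γ => ?_
    change ((Contramodule.contraextension (𝒞.map γ).toCoalgHom).map u).lin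
      ((exComponent 𝒞 x N β γ).lin m) = (exComponent 𝒞 x N' β γ).lin
        (fun α => ((Contramodule.contraextension (𝒞.map α).toCoalgHom).map u).lin (m α))
    by_cases h : y ≤ x
    · refine (congrArg _ (exComponent_lin 𝒞 x N β γ (homOfLE h) m)).trans (Eq.trans ?_
        (exComponent_lin 𝒞 x N' β γ (homOfLE h) (fun α =>
          ((Contramodule.contraextension (𝒞.map α).toCoalgHom).map u).lin (m α))).symm)
      exact Contramodule.contraextensionTransition_naturality _ _ _ _ u _
    · rw [exComponent, dif_neg h, exComponent, dif_neg h]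
      exact map_zero _

/-- The functor `ex_x` from `𝒞_x`-contramodules to trans-contramodules over `𝒞`. -/
noncomputable def ex : Contramodule K (𝒞.obj x) ⥤ TransContramodule 𝒞 where
  obj N := exObj 𝒞 x N
  map u := exMap 𝒞 x u
  map_id N := by
    refine Hom.ext (funext fun y => Contramodule.hom_ext (LinearMap.ext fun m => funext fun α => ?_))
    change ((Contramodule.contraextension (𝒞.map α).toCoalgHom).map (𝟙 N)).lin (m α) = m α
    rw [CategoryTheory.Functor.map_id]
    rfl
  map_comp u v := by
    refine Hom.ext (funext fun y => Contramodule.hom_ext (LinearMap.ext fun m => funext fun α => ?_))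
    change ((Contramodule.contraextension (𝒞.map α).toCoalgHom).map (u ≫ v)).lin (m α) = _
    rw [CategoryTheory.Functor.map_comp]
    rfl

end Extension

end TransContramodule

/-! A morphism from the free contramodule `C^*` to `M` is an element of `M`, and `ex_x` is left
adjoint to evaluation at `x`. Hence morphisms `ex_x(C_x^*) → M` are elements of `M_x`
(`exToElement`), and the claims about generators become statements about elements.

Since `K` is a field, linear maps split and `Hom_K(C, -)` is exact. Kernels and cokernels of
trans-contramodules are therefore those of the underlying vector spaces in each component.
Epimorphisms are the componentwise surjections, so `ex_x(C_x^*)` is projective. Elements detect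
equality of morphisms, and a monomorphism that every element lifts through is bijective in each
component.

Colimits of contramodules are quotients of free contramodules. Those of trans-contramodules are
computed componentwise: a structure morphism leaves `M_y`, so it is induced on the colimit by a
cocone, and contrarestriction need not preserve colimits. In particular evaluation at `x` preserves
colimits, so its left adjoint `ex_x` preserves `κ`-presentable objects for every regular `κ`.
Cocompleteness and a strong generator of `κ`-presentable objects give local `κ`-presentability.

It remains to find one `κ` for which every `C_x^*` is `κ`-presentable. If `κ` exceeds `dim C`, then
`Hom_K(C, -)` commutes with `κ`-filtered colimits of vector spaces. Such a colimit of contramodules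
thus inherits a contraction, and the forgetful functor, which `C^*` represents, preserves it. A
regular `κ` above all the dimensions exists because `X` is small. -/

open CategoryTheory.Limits

/-! ### Free contramodules, subcontramodules and quotients -/

namespace Contramodule

variable {K : Type u} [Field K] {C : Type u} [AddCommGroup C] [Module K C] [Coalgebra K C]

/-- A submodule of a contramodule is a subcontramodule if it is stable under the contraction. -/
def IsClosed (M : Contramodule K C) (R : Submodule K M.carrier) : Prop :=
  ∀ f : C →ₗ[K] M.carrier, (∀ c, f c ∈ R) → M.π f ∈ R

variable (C) in
/-- The unit `V → Hom_K(C, V)` of the free contramodule on `V`. -/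
noncomputable def unit (V : Type u) [AddCommGroup V] [Module K V] : V →ₗ[K] C →ₗ[K] V :=
  LinearMap.lcomp K V (Coalgebra.counit (R := K) (A := C)) ∘ₗ
    (LinearMap.ringLmapEquivSelf K K V).symm.toLinearMap

theorem unit_apply {V : Type u} [AddCommGroup V] [Module K V] (v : V) :
    unit C V v = LinearMap.toSpanSingleton K V v ∘ₗ Coalgebra.counit := by
  ext c
  simp [unit]

theorem π_unit (M : Contramodule K C) (m : M.carrier) : M.π (unit C _ m) = m := by
  rw [unit_apply, M.contra_counit]

theorem comp_unit {V W : Type u} [AddCommGroup V] [Module K V] [AddCommGroup W] [Module K W]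
    (u : V →ₗ[K] W) (v : V) : u ∘ₗ unit C V v = unit C W (u v) := by
  ext c
  simp [unit_apply]

/-- This is the counit law on the second tensor factor; the contraunit axiom of `free` uses the
first. It makes the elements `unit C V v` generate the free contramodule. -/
theorem freeπ_unit_comp {V : Type u} [AddCommGroup V] [Module K V] (f : C →ₗ[K] V) :
    freeπ C V (unit C V ∘ₗ f) = f := by
  have key : TensorProduct.lift (unit C V ∘ₗ f) =
      (TensorProduct.rid K V).toLinearMap ∘ₗ TensorProduct.map f Coalgebra.counit := by
    ext a b
    simp [unit_apply]
  have key2 : TensorProduct.map f (Coalgebra.counit (R := K) (A := C)) =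
      LinearMap.rTensor K f ∘ₗ LinearMap.lTensor C Coalgebra.counit := by
    ext a
    simp
  ext c
  rw [freeπ_eq, key, key2]
  simp only [LinearMap.comp_apply, Coalgebra.lTensor_counit_comul]
  simp

/-- The morphism from the free contramodule induced by a linear map. -/
noncomputable def freeDesc {V : Type u} [AddCommGroup V] [Module K V] {N : Contramodule K C}
    (u : V →ₗ[K] N.carrier) : free K C V ⟶ N where
  lin := N.π ∘ₗ LinearMap.compRight K u
  comm f := by
    refine Eq.trans ?_ (N.contra_assoc (LinearMap.compRight K u ∘ₗ f)).symm
    change N.π (u ∘ₗ TensorProduct.lift f ∘ₗ Coalgebra.comul) = _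
    rw [← LinearMap.comp_assoc]
    refine congrArg (fun t : C ⊗[K] C →ₗ[K] N.carrier => N.π (t ∘ₗ Coalgebra.comul)) ?_
    refine TensorProduct.ext' fun a b => ?_
    exact congrArg u (TensorProduct.lift.tmul a b)

theorem freeDesc_lin_apply {V : Type u} [AddCommGroup V] [Module K V] {N : Contramodule K C}
    (u : V →ₗ[K] N.carrier) (f : C →ₗ[K] V) : (freeDesc u).lin f = N.π (u ∘ₗ f) := rfl

theorem freeDesc_unit {V : Type u} [AddCommGroup V] [Module K V] {N : Contramodule K C}
    (u : V →ₗ[K] N.carrier) (v : V) : (freeDesc u).lin (unit C V v) = u v := by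
  rw [freeDesc_lin_apply, comp_unit, π_unit]

/-- By `freeπ_unit_comp`, every `f` is the contraction of `unit C V ∘ₗ f`, so a map compatible with
contractions is determined by its values on the unit. -/
theorem free_lin_apply {V : Type u} [AddCommGroup V] [Module K V] {W : Type u} [AddCommGroup W]
    [Module K W] (p : (C →ₗ[K] W) →ₗ[K] W) (φ : (C →ₗ[K] V) →ₗ[K] W)
    (hφ : ∀ f : C →ₗ[K] C →ₗ[K] V, φ (freeπ C V f) = p (φ ∘ₗ f)) (f : C →ₗ[K] V) :
    φ f = p (φ ∘ₗ unit C V ∘ₗ f) := by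
  rw [← hφ, freeπ_unit_comp]

theorem free_hom_ext {V : Type u} [AddCommGroup V] [Module K V] {N : Contramodule K C}
    {φ ψ : free K C V ⟶ N} (h : ∀ v, φ.lin (unit C V v) = ψ.lin (unit C V v)) : φ = ψ := by
  refine hom_ext (LinearMap.ext fun (f : C →ₗ[K] V) => ?_)
  refine (free_lin_apply N.π φ.lin φ.comm f).trans
    (Eq.trans ?_ (free_lin_apply N.π ψ.lin ψ.comm f).symm)
  exact congrArg N.π (LinearMap.ext fun c => h (f c))

/-- The contramodule structure on a subcontramodule. -/
noncomputable def sub (M : Contramodule K C) (R : Submodule K M.carrier) (hR : M.IsClosed R) :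
    Contramodule K C where
  carrier := R
  π := (M.π ∘ₗ LinearMap.compRight K R.subtype).codRestrict R
    fun f => hR _ fun c => (f c).2
  contra_counit m := Subtype.ext <| by
    refine Eq.trans (congrArg M.π ?_) (M.contra_counit m)
    ext c
    simp
  contra_assoc g := Subtype.ext <| by
    refine Eq.trans (M.contra_assoc (LinearMap.compRight K R.subtype ∘ₗ g)) ?_
    refine congrArg M.π ?_
    change _ = R.subtype ∘ₗ TensorProduct.lift g ∘ₗ Coalgebra.comul
    rw [← LinearMap.comp_assoc]
    congr 1
    ext a b
    simp

/-- The projection onto a quotient contramodule. -/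
noncomputable def quotientMk (M : Contramodule K C) (R : Submodule K M.carrier)
    (hR : M.IsClosed R) : M ⟶ M.quotient R hR where
  lin := R.mkQ
  comm f := (quotientπ_mkQ_comp M R hR f).symm

/-- The morphism from a quotient contramodule induced by a morphism vanishing on the
subcontramodule. -/
noncomputable def quotientDesc (M : Contramodule K C) (R : Submodule K M.carrier)
    (hR : M.IsClosed R) {N : Contramodule K C} (u : M ⟶ N) (hu : R ≤ LinearMap.ker u.lin) :
    M.quotient R hR ⟶ N where
  lin := R.liftQ u.lin hu
  comm f := by
    obtain ⟨f, rfl⟩ := exists_lift R f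
    refine (congrArg (R.liftQ u.lin hu) (quotientπ_mkQ_comp M R hR f)).trans ?_
    refine (R.liftQ_apply u.lin (M.π f)).trans ((u.comm f).trans (congrArg N.π ?_))
    ext c
    exact (R.liftQ_apply u.lin (h := hu) (f c)).symm

/-- The smallest subcontramodule containing a set. -/
def closure (M : Contramodule K C) (S : Set M.carrier) : Submodule K M.carrier :=
  sInf {R | S ⊆ R ∧ M.IsClosed R}

theorem subset_closure (M : Contramodule K C) (S : Set M.carrier) : S ⊆ M.closure S :=
  fun _ hm => (Submodule.mem_sInf).2 fun _ hR => hR.1 hm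

theorem closure_isClosed (M : Contramodule K C) (S : Set M.carrier) :
    M.IsClosed (M.closure S) :=
  fun f hf => (Submodule.mem_sInf).2 fun R hR =>
    hR.2 f fun c => (Submodule.mem_sInf).1 (hf c) R hR

theorem closure_le (M : Contramodule K C) {S : Set M.carrier} {R : Submodule K M.carrier}
    (hS : S ⊆ R) (hR : M.IsClosed R) : M.closure S ≤ R :=
  sInf_le ⟨hS, hR⟩

/-- The target carries only a linear map `p`, with no axioms. This lets the lemma apply to a
difference of two maps whose targets are not the same contramodule on the nose. -/
theorem ker_isClosed {M : Contramodule K C} {W : Type u} [AddCommGroup W] [Module K W]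
    (p : (C →ₗ[K] W) →ₗ[K] W) (φ : M.carrier →ₗ[K] W) (hφ : ∀ f, φ (M.π f) = p (φ ∘ₗ f)) :
    M.IsClosed (LinearMap.ker φ) := fun f hf => by
  rw [LinearMap.mem_ker, hφ]
  have : φ ∘ₗ f = 0 := LinearMap.ext hf
  rw [this, map_zero]

/-- Over a field a map from `C` into the range lifts along a linear section to a map into `M`, where
it can be contracted. -/
theorem range_isClosed {M N : Contramodule K C} (u : M ⟶ N) :
    N.IsClosed (LinearMap.range u.lin) := fun f hf => by
  obtain ⟨t, ht⟩ := u.lin.rangeRestrict.exists_rightInverse_of_surjective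
    (LinearMap.range_rangeRestrict _)
  let f' : C →ₗ[K] LinearMap.range u.lin := LinearMap.codRestrict _ f hf
  have h : f = u.lin ∘ₗ (t ∘ₗ f') := by
    ext1 c
    exact (congrArg Subtype.val (LinearMap.congr_fun ht (f' c))).symm
  rw [h]
  exact ⟨_, u.comm _⟩

/-! ### Colimits of contramodules -/

section Colimits

variable {J : Type u} [SmallCategory J] (F : J ⥤ Contramodule K C)

open Classical in
/-- The relations that define the colimit of a diagram of contramodules as a quotient of the free
contramodule on the direct sum. -/
inductive ColimitRel : (C →ₗ[K] DirectSum J fun j => (F.obj j).carrier) → Prop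
  | contraction (j : J) (f : C →ₗ[K] (F.obj j).carrier) :
      ColimitRel (DirectSum.lof K J (fun j => (F.obj j).carrier) j ∘ₗ f -
        unit C _ (DirectSum.lof K J (fun j => (F.obj j).carrier) j ((F.obj j).π f)))
  | transition {i j : J} (φ : i ⟶ j) (m : (F.obj i).carrier) :
      ColimitRel (unit C _ (DirectSum.lof K J (fun j => (F.obj j).carrier) i m -
        DirectSum.lof K J (fun j => (F.obj j).carrier) j ((F.map φ).lin m)))

/-- The free contramodule on the direct sum of a diagram. -/
noncomputable abbrev freeSum : Contramodule K C :=
  free K C (DirectSum J fun j => (F.obj j).carrier)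

/-- The subcontramodule generated by the relations that define the colimit. -/
noncomputable def colimitSubmodule : Submodule K (freeSum F).carrier :=
  closure (freeSum F) {f | ColimitRel F f}

theorem colimitSubmodule_isClosed : (freeSum F).IsClosed (colimitSubmodule F) :=
  closure_isClosed _ _

open Classical in
/-- The components of the explicit colimit cocone. -/
noncomputable def colimitι (j : J) :
    F.obj j ⟶ (freeSum F).quotient (colimitSubmodule F) (colimitSubmodule_isClosed F) where
  lin := (colimitSubmodule F).mkQ ∘ₗ unit C _ ∘ₗ
    DirectSum.lof K J (fun j => (F.obj j).carrier) j
  comm f := by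
    -- By `freeπ_unit_comp`, the contraction of `unit ∘ lof ∘ f` in the free contramodule is `lof ∘
    -- f`. The relation `contraction` identifies this with the unit at `lof (π f)`.
    refine Eq.trans ?_ (((freeSum F).quotientMk (colimitSubmodule F)
      (colimitSubmodule_isClosed F)).comm
      (unit C _ ∘ₗ DirectSum.lof K J (fun j => (F.obj j).carrier) j ∘ₗ f))
    refine ((Submodule.Quotient.eq (colimitSubmodule F)).2 ?_).symm
    refine (congrArg (fun t : C →ₗ[K] DirectSum J fun j => (F.obj j).carrier =>
      t - unit C _ (DirectSum.lof K J (fun j => (F.obj j).carrier) j ((F.obj j).π f)) ∈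
        colimitSubmodule F) (freeπ_unit_comp _)).mpr ?_
    exact subset_closure _ _ (.contraction j f)

/-- The explicit colimit cocone of a diagram of contramodules. -/
noncomputable def colimitCocone : Cocone F where
  pt := (freeSum F).quotient (colimitSubmodule F) (colimitSubmodule_isClosed F)
  ι :=
    { app j := colimitι F j
      naturality i j φ := by
        classical
        refine hom_ext (LinearMap.ext fun m => ?_)
        refine ((Submodule.Quotient.eq (colimitSubmodule F)).2 ?_).symm
        refine (congrArg (· ∈ colimitSubmodule F) (map_sub (unit C _) _ _)).mp ?_
        exact subset_closure _ _ (.transition φ m) }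

open Classical in
/-- The linear map on the direct sum induced by a cocone. -/
noncomputable def coconeLin (c : Cocone F) :
    (DirectSum J fun j => (F.obj j).carrier) →ₗ[K] c.pt.carrier :=
  DirectSum.toModule K J _ fun j => (c.ι.app j).lin

open Classical in
theorem coconeLin_lof (c : Cocone F) (j : J) (m : (F.obj j).carrier) :
    coconeLin F c (DirectSum.lof K J (fun j => (F.obj j).carrier) j m) = (c.ι.app j).lin m :=
  DirectSum.toModule_lof _ _ _

theorem app_map_lin {F : J ⥤ Contramodule K C} (c : Cocone F) {i j : J} (φ : i ⟶ j)
    (m : (F.obj i).carrier) :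
    (c.ι.app j).lin ((F.map φ).lin m) = (c.ι.app i).lin m :=
  LinearMap.congr_fun (congrArg Hom.lin (c.w φ)) m

/-- The kernel is a subcontramodule, so only the generating relations need checking: one vanishes
because the legs of the cocone respect contractions, the other by naturality. -/
theorem colimitSubmodule_le_ker (c : Cocone F) :
    colimitSubmodule F ≤ LinearMap.ker (freeDesc (coconeLin F c)).lin := by
  refine closure_le _ ?_ (ker_isClosed c.pt.π _ (freeDesc (coconeLin F c)).comm)
  classical
  rintro _ (⟨j, f⟩ | ⟨φ, m⟩)
  · refine LinearMap.mem_ker.2 ((map_sub (freeDesc (coconeLin F c)).lin _ _).trans ?_)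
    refine sub_eq_zero.2 (Eq.trans ?_ (freeDesc_unit _ _).symm)
    rw [coconeLin_lof, (c.ι.app j).comm]
    refine congrArg c.pt.π (LinearMap.ext fun m => ?_)
    exact coconeLin_lof F c j (f m)
  · refine LinearMap.mem_ker.2 ((freeDesc_unit _ _).trans ?_)
    rw [map_sub, coconeLin_lof, coconeLin_lof, app_map_lin, sub_self]

/-- The explicit cocone is a colimit. -/
noncomputable def isColimitColimitCocone : IsColimit (colimitCocone F) where
  desc c := quotientDesc (freeSum F) (colimitSubmodule F) (colimitSubmodule_isClosed F)
    (freeDesc (coconeLin F c)) (colimitSubmodule_le_ker F c)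
  fac c j := by
    classical
    refine hom_ext (LinearMap.ext fun m => ?_)
    exact (freeDesc_unit (coconeLin F c) _).trans (coconeLin_lof F c j m)
  uniq c φ hφ := by
    classical
    have h : quotientMk (freeSum F) (colimitSubmodule F) (colimitSubmodule_isClosed F) ≫ φ =
        freeDesc (coconeLin F c) := by
      refine free_hom_ext fun v => Eq.trans ?_ (freeDesc_unit _ _).symm
      refine LinearMap.congr_fun (f := φ.lin ∘ₗ (colimitSubmodule F).mkQ ∘ₗ unit C _) ?_ v
      refine DirectSum.linearMap_ext K fun j => LinearMap.ext fun m => ?_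
      refine (LinearMap.congr_fun (congrArg Hom.lin (hφ j)) m).trans ?_
      exact (coconeLin_lof F c j m).symm
    refine hom_ext (Submodule.linearMap_qext (colimitSubmodule F) (LinearMap.ext fun f => ?_))
    exact LinearMap.congr_fun (congrArg Hom.lin h) f

instance : HasColimitsOfSize.{u, u} (Contramodule K C) where
  has_colimits_of_shape _ _ := ⟨fun F => ⟨⟨⟨_, isColimitColimitCocone F⟩⟩⟩⟩

variable {F}

/-- A colimit of contramodules is generated, as a contramodule, by the images of the terms of the
diagram. -/
theorem eq_top_of_isColimit {c : Cocone F} (hc : IsColimit c) {R : Submodule K c.pt.carrier}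
    (hR : c.pt.IsClosed R) (h : ∀ j m, (c.ι.app j).lin m ∈ R) : R = ⊤ := by
  -- The projection to the quotient by `R` kills every term of the diagram, so it is zero by
  -- uniqueness of maps out of a colimit.
  have : c.pt.quotientMk R hR = zeroHom _ _ := hc.hom_ext fun j =>
    hom_ext (LinearMap.ext fun m => (Submodule.Quotient.mk_eq_zero R).2 (h j m))
  refine eq_top_iff.2 fun m _ => (Submodule.Quotient.mk_eq_zero R).1 ?_
  exact LinearMap.congr_fun (congrArg Hom.lin this) m

/-- The locus where `φ` and `ψ` agree is a subcontramodule containing the images of all terms.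
Working with linear maps and a bare `p` avoids transport along equalities of coalgebra morphisms. -/
theorem lin_ext_of_isColimit {c : Cocone F} (hc : IsColimit c) {W : Type u} [AddCommGroup W]
    [Module K W] (p : (C →ₗ[K] W) →ₗ[K] W) {φ ψ : c.pt.carrier →ₗ[K] W}
    (hφ : ∀ f, φ (c.pt.π f) = p (φ ∘ₗ f)) (hψ : ∀ f, ψ (c.pt.π f) = p (ψ ∘ₗ f))
    (h : ∀ j m, φ ((c.ι.app j).lin m) = ψ ((c.ι.app j).lin m)) : φ = ψ := by
  rw [← sub_eq_zero, ← LinearMap.ker_eq_top]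
  refine eq_top_of_isColimit hc (ker_isClosed p _ fun f => ?_) fun j m => ?_
  · rw [LinearMap.sub_apply, hφ, hψ, ← map_sub]
    rfl
  · rw [LinearMap.mem_ker, LinearMap.sub_apply, h, sub_self]

end Colimits

end Contramodule

/-! ### Maps from small vector spaces to filtered colimits -/

section ModuleColimits

variable {K : Type u} [Field K] {J : Type u} [SmallCategory J] {κ : Cardinal.{u}}
  [Fact κ.IsRegular] [IsCardinalFiltered J κ] {F : J ⥤ ModuleCat.{u} K} {c : Cocone F}
  {D ι : Type u} [AddCommGroup D] [Module K D]

/-- A linear map from a vector space with fewer than `κ` basis vectors to a `κ`-filtered colimit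
factors through a term of the diagram. -/
theorem ModuleCat.exists_comp_eq_of_isColimit (hc : IsColimit c) (b : Module.Basis ι K D)
    (hι : HasCardinalLT ι κ) (f : D →ₗ[K] c.pt) :
    ∃ (j : J) (g : D →ₗ[K] F.obj j), (c.ι.app j).hom ∘ₗ g = f := by
  have := isFiltered_of_isCardinalFiltered J κ
  choose j x hx using fun i => Concrete.isColimit_exists_rep F hc (f (b i))
  refine ⟨IsCardinalFiltered.max j hι,
    b.constr K fun i => (F.map (IsCardinalFiltered.toMax j hι i)).hom (x i),
    b.ext fun i => ?_⟩
  rw [LinearMap.comp_apply, Module.Basis.constr_basis, ← hx]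
  exact ConcreteCategory.congr_hom (c.w (IsCardinalFiltered.toMax j hι i)) (x i)

/-- A linear map from a vector space with fewer than `κ` basis vectors to a term of a
`κ`-filtered diagram that vanishes in the colimit vanishes in some term of the diagram. -/
theorem ModuleCat.exists_comp_eq_zero_of_isColimit (hc : IsColimit c) (b : Module.Basis ι K D)
    (hι : HasCardinalLT ι κ) {i : J} (f : D →ₗ[K] F.obj i) (h : (c.ι.app i).hom ∘ₗ f = 0) :
    ∃ (k : J) (φ : i ⟶ k), (F.map φ).hom ∘ₗ f = 0 := by
  have := isFiltered_of_isCardinalFiltered J κ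
  have h1 (a : ι) : ∃ (k : J) (φ : i ⟶ k), F.map φ (f (b a)) = 0 := by
    obtain ⟨k, φ, ψ, hk⟩ := Concrete.isColimit_exists_of_rep_eq F hc (f (b a)) (0 : F.obj i)
      ((LinearMap.congr_fun h (b a)).trans (map_zero (c.ι.app i).hom).symm)
    exact ⟨k, φ, hk.trans (map_zero (F.map ψ).hom)⟩
  choose k φ hk using h1
  obtain ⟨l, α, φ', hφ⟩ := IsCardinalFiltered.wideSpan φ hι
  refine ⟨l, φ', b.ext fun a => ?_⟩
  rw [← hφ a, F.map_comp]
  exact (congrArg (F.map (α a)).hom (hk a)).trans (map_zero (F.map (α a)).hom)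

/-- Two linear maps from a vector space with fewer than `κ` basis vectors to terms of a
`κ`-filtered diagram that agree in the colimit agree in some term of the diagram. -/
theorem ModuleCat.exists_comp_eq_comp_of_isColimit (hc : IsColimit c) (b : Module.Basis ι K D)
    (hι : HasCardinalLT ι κ) {i j : J} (f : D →ₗ[K] F.obj i) (g : D →ₗ[K] F.obj j)
    (h : (c.ι.app i).hom ∘ₗ f = (c.ι.app j).hom ∘ₗ g) :
    ∃ (k : J) (φ : i ⟶ k) (ψ : j ⟶ k), (F.map φ).hom ∘ₗ f = (F.map ψ).hom ∘ₗ g := by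
  have := isFiltered_of_isCardinalFiltered J κ
  let u := IsFiltered.leftToMax i j
  let v := IsFiltered.rightToMax i j
  obtain ⟨k, φ, hφ⟩ := exists_comp_eq_zero_of_isColimit hc b hι
    ((F.map u).hom ∘ₗ f - (F.map v).hom ∘ₗ g) (by
      rw [LinearMap.comp_sub, sub_eq_zero, ← LinearMap.comp_assoc, ← LinearMap.comp_assoc,
        ← ModuleCat.hom_comp, ← ModuleCat.hom_comp, c.w, c.w, h])
  refine ⟨k, u ≫ φ, v ≫ φ, ?_⟩
  rw [LinearMap.comp_sub, sub_eq_zero] at hφ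
  simpa [LinearMap.comp_assoc] using hφ

end ModuleColimits

/-! ### Filtered colimits of contramodules and presentability of `C^*` -/

namespace Contramodule

variable {K : Type u} [Field K] {C : Type u} [AddCommGroup C] [Module K C] [Coalgebra K C]

/-- The forgetful functor from contramodules to vector spaces. -/
def forgetModule : Contramodule K C ⥤ ModuleCat.{u} K where
  obj M := ModuleCat.of K M.carrier
  map f := ModuleCat.ofHom f.lin

section

variable {J : Type u} [SmallCategory J] {κ : Cardinal.{u}} [Fact κ.IsRegular]
  [IsCardinalFiltered J κ] (F : J ⥤ Contramodule K C) {ι : Type u} (b : Module.Basis ι K C)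
  (hι : HasCardinalLT ι κ) {c : Cocone (F ⋙ forgetModule)} (hc : IsColimit c)

/-- The map from a term of a diagram to the colimit of the underlying vector spaces. -/
def moduleι (c : Cocone (F ⋙ forgetModule)) (j : J) : (F.obj j).carrier →ₗ[K] c.pt :=
  (c.ι.app j).hom

theorem moduleι_map {i j : J} (φ : i ⟶ j) (m : (F.obj i).carrier) :
    moduleι F c j ((F.map φ).lin m) = moduleι F c i m :=
  ConcreteCategory.congr_hom (c.w φ) m

include b hc hι in
-- Two lifts of one map to the colimit agree at a later stage, and transition morphisms commute with
-- contractions. So contracting in the colimit does not depend on the lift.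
theorem moduleι_π_eq {i j : J} (f : C →ₗ[K] (F.obj i).carrier) (g : C →ₗ[K] (F.obj j).carrier)
    (h : moduleι F c i ∘ₗ f = moduleι F c j ∘ₗ g) :
    moduleι F c i ((F.obj i).π f) = moduleι F c j ((F.obj j).π g) := by
  obtain ⟨k, φ, ψ, hk⟩ := ModuleCat.exists_comp_eq_comp_of_isColimit hc b hι
    (F := F ⋙ forgetModule) f g h
  rw [← moduleι_map F φ, ← moduleι_map F ψ, (F.map φ).comm, (F.map ψ).comm]
  exact congrArg (fun t => moduleι F c k ((F.obj k).π t)) hk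

include hc in
theorem exists_moduleι_comp_eq {D ι' : Type u} [AddCommGroup D] [Module K D]
    (b' : Module.Basis ι' K D) (hι' : HasCardinalLT ι' κ) (f : D →ₗ[K] c.pt) :
    ∃ (j : J) (g : D →ₗ[K] (F.obj j).carrier), moduleι F c j ∘ₗ g = f :=
  ModuleCat.exists_comp_eq_of_isColimit hc b' hι' f

include b hc hι in
/-- The contraction on a `κ`-filtered colimit of the underlying vector spaces of contramodules. -/
theorem exists_colimitπ : ∃ p : (C →ₗ[K] c.pt) →ₗ[K] c.pt,
    ∀ (j : J) (g : C →ₗ[K] (F.obj j).carrier),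
      p (moduleι F c j ∘ₗ g) = moduleι F c j ((F.obj j).π g) := by
  have := isFiltered_of_isCardinalFiltered J κ
  choose j g hg using fun f : C →ₗ[K] c.pt => exists_moduleι_comp_eq F hc b hι f
  have key (f : C →ₗ[K] c.pt) (i : J) (h : C →ₗ[K] (F.obj i).carrier)
      (hf : moduleι F c i ∘ₗ h = f) :
      moduleι F c (j f) ((F.obj (j f)).π (g f)) = moduleι F c i ((F.obj i).π h) :=
    moduleι_π_eq F b hι hc _ _ ((hg f).trans hf.symm)
  refine ⟨{ toFun f := moduleι F c (j f) ((F.obj (j f)).π (g f))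
            map_add' f f' := ?_
            map_smul' a f := ?_ }, fun i h => key _ i h rfl⟩
  -- The chosen lifts of `f` and `f'` live at different stages; they are added after moving both to
  -- a common one.
  · let u := IsFiltered.leftToMax (j f) (j f')
    let v := IsFiltered.rightToMax (j f) (j f')
    have hu : moduleι F c _ ∘ₗ (F.map u).lin ∘ₗ g f = f := by
      refine Eq.trans (LinearMap.ext fun x => ?_) (hg f)
      exact moduleι_map F u _
    have hv : moduleι F c _ ∘ₗ (F.map v).lin ∘ₗ g f' = f' := by
      refine Eq.trans (LinearMap.ext fun x => ?_) (hg f')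
      exact moduleι_map F v _
    rw [key f _ _ hu, key f' _ _ hv, key (f + f') _ ((F.map u).lin ∘ₗ g f + (F.map v).lin ∘ₗ g f')
      (by rw [LinearMap.comp_add, hu, hv]), map_add, map_add]
  · rw [key (a • f) (j f) (a • g f) (by rw [LinearMap.comp_smul, hg]), map_smul, map_smul]
    rfl

include b hc hι in
/-- The forgetful functor to vector spaces lifts `κ`-filtered colimits to cocones. -/
theorem exists_cocone_forgetModule : ∃ (d : Cocone F) (e : d.pt.carrier →ₗ[K] c.pt),
    ∀ j m, e ((d.ι.app j).lin m) = moduleι F c j m := by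
  have := isFiltered_of_isCardinalFiltered J κ
  obtain ⟨p, hp⟩ := exists_colimitπ F b hι hc
  -- Contraassociativity is checked by lifting a map from `C ⊗ C` to one stage, which needs a basis
  -- of `C ⊗ C` of size below `κ`.
  have hι2 : HasCardinalLT (ι × ι) κ :=
    hasCardinalLT_prod (Cardinal.IsRegular.aleph0_le Fact.out) hι hι
  let W : Contramodule K C :=
    { carrier := c.pt
      π := p
      contra_counit m := by
        obtain ⟨j, (x : (F.obj j).carrier), rfl⟩ :=
          Concrete.isColimit_exists_rep (F ⋙ forgetModule) hc m
        have h : LinearMap.toSpanSingleton K c.pt (moduleι F c j x) ∘ₗ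
            Coalgebra.counit (R := K) (A := C) = moduleι F c j ∘ₗ
              (LinearMap.toSpanSingleton K (F.obj j).carrier x ∘ₗ Coalgebra.counit) := by
          ext
          simp only [LinearMap.comp_apply, LinearMap.toSpanSingleton_apply, map_smul]
        refine (congrArg p h).trans ((hp j _).trans ?_)
        exact congrArg (moduleι F c j) ((F.obj j).contra_counit x)
      contra_assoc g := by
        obtain ⟨j, h, hh⟩ := exists_moduleι_comp_eq F hc (b.tensorProduct b) hι2
          (TensorProduct.lift g)
        have h1 : g = LinearMap.compRight K (moduleι F c j) ∘ₗ TensorProduct.curry h := by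
          ext x y
          exact (LinearMap.congr_fun hh (x ⊗ₜ y)).symm
        have h2 : p ∘ₗ g = moduleι F c j ∘ₗ ((F.obj j).π ∘ₗ TensorProduct.curry h) := by
          rw [h1]
          ext x
          exact hp j _
        rw [h2, ← hh, LinearMap.comp_assoc, hp, hp, (F.obj j).contra_assoc]
        refine congrArg (fun t => moduleι F c j ((F.obj j).π (t ∘ₗ Coalgebra.comul))) ?_
        exact TensorProduct.ext' fun x y => TensorProduct.lift.tmul x y }
  exact ⟨{  pt := W
            ι := { app j := { lin := moduleι F c j
                              comm f := (hp j f).symm }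
                   naturality i j φ := hom_ext (LinearMap.ext fun m => moduleι_map F φ m) } },
    LinearMap.id, fun j m => rfl⟩

variable {F}

include b hι in
-- The vector space colimit is itself a contramodule under the diagram, so an element that dies in
-- the contramodule colimit dies there too, hence at some stage.
theorem exists_map_eq_zero_of_isColimit {d : Cocone F} (hd : IsColimit d) {i : J}
    (m : (F.obj i).carrier) (hm : (d.ι.app i).lin m = 0) :
    ∃ (k : J) (φ : i ⟶ k), (F.map φ).lin m = 0 := by
  have := isFiltered_of_isCardinalFiltered J κ
  have hc := colimit.isColimit (F ⋙ forgetModule)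
  obtain ⟨d', e, he⟩ := exists_cocone_forgetModule F b hι hc
  have h0 : moduleι F (colimit.cocone (F ⋙ forgetModule)) i m = 0 := by
    rw [← he, ← hd.fac d' i]
    exact (congrArg (fun t => e ((hd.desc d').lin t)) hm).trans (by simp)
  obtain ⟨k, φ, ψ, hk⟩ := Concrete.isColimit_exists_of_rep_eq (F ⋙ forgetModule) hc
    (m : (F ⋙ forgetModule).obj i) (0 : (F ⋙ forgetModule).obj i)
    (h0.trans (map_zero (moduleι F _ i)).symm)
  exact ⟨k, φ, hk.trans (map_zero (F.map ψ).lin)⟩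

include b hι in
-- The image of the vector space colimit is closed under contraction, since a map from `C` into it
-- lifts to a single stage. It contains the images of all terms, so it is everything.
theorem exists_rep_of_isColimit {d : Cocone F} (hd : IsColimit d) (m : d.pt.carrier) :
    ∃ (j : J) (x : (F.obj j).carrier), (d.ι.app j).lin x = m := by
  have := isFiltered_of_isCardinalFiltered J κ
  have hc := colimit.isColimit (F ⋙ forgetModule)
  let q : colimit (F ⋙ forgetModule) ⟶ ModuleCat.of K d.pt.carrier :=
    hc.desc (forgetModule.mapCocone d)
  have hq (j : J) (x : (F.obj j).carrier) :
      q.hom (moduleι F (colimit.cocone (F ⋙ forgetModule)) j x) = (d.ι.app j).lin x :=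
    ConcreteCategory.congr_hom (hc.fac (forgetModule.mapCocone d) j) x
  have htop : LinearMap.range q.hom = ⊤ := by
    refine eq_top_of_isColimit hd (fun f hf => ?_) fun j x => ⟨_, hq j x⟩
    obtain ⟨t, ht⟩ := q.hom.rangeRestrict.exists_rightInverse_of_surjective
      (LinearMap.range_rangeRestrict _)
    let f' : C →ₗ[K] LinearMap.range q.hom := LinearMap.codRestrict _ f hf
    obtain ⟨j, g, hg⟩ := exists_moduleι_comp_eq F hc b hι (t ∘ₗ f')
    have h : f = (d.ι.app j).lin ∘ₗ g := by
      ext1 x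
      refine (congrArg Subtype.val (LinearMap.congr_fun ht (f' x))).symm.trans ?_
      refine Eq.trans ?_ (hq j (g x))
      exact congrArg q.hom (LinearMap.congr_fun hg x).symm
    rw [h]
    exact ⟨_, (hq j _).trans ((d.ι.app j).comm g)⟩
  obtain ⟨w, rfl⟩ := LinearMap.range_eq_top.1 htop m
  obtain ⟨j, x, rfl⟩ := Concrete.isColimit_exists_rep (F ⋙ forgetModule) hc w
  exact ⟨j, x, (hq j x).symm⟩

end

/-- The morphism `C^* → M` that corresponds to an element of `M`. -/
noncomputable def ofElement {M : Contramodule K C} (m : M.carrier) : dual K C ⟶ M :=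
  freeDesc (LinearMap.toSpanSingleton K M.carrier m)

/-- The element of `M` that corresponds to a morphism `C^* → M`. -/
noncomputable def toElement {M : Contramodule K C} (f : dual K C ⟶ M) : M.carrier :=
  f.lin (unit C K 1)

theorem toElement_ofElement {M : Contramodule K C} (m : M.carrier) :
    toElement (ofElement m) = m :=
  (freeDesc_unit _ _).trans (LinearMap.toSpanSingleton_apply_one K _ m)

theorem toElement_comp {M N : Contramodule K C} (f : dual K C ⟶ M) (g : M ⟶ N) :
    toElement (f ≫ g) = g.lin (toElement f) := rfl

theorem toElement_injective {M : Contramodule K C} {f g : dual K C ⟶ M}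
    (h : toElement f = toElement g) : f = g := by
  refine free_hom_ext fun v => ?_
  refine LinearMap.congr_fun (f := f.lin ∘ₗ unit C K) (g := g.lin ∘ₗ unit C K) ?_ v
  exact LinearMap.ext_ring h

/-- `Hom(C^*, -)` is the underlying set functor, and the two lemmas above say that it preserves
`κ`-filtered colimits. -/
theorem isCardinalPresentable_dual {κ : Cardinal.{u}} [Fact κ.IsRegular] {ι : Type u}
    (b : Module.Basis ι K C) (hι : HasCardinalLT ι κ) :
    IsCardinalPresentable (dual K C) κ where
  preservesColimitOfShape J _ _ := ⟨fun {F} => ⟨fun {d} hd => ⟨by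
    have := isFiltered_of_isCardinalFiltered J κ
    refine Types.FilteredColimit.isColimitOf' _ _ (fun f => ?_) (fun i f g h => ?_)
    · obtain ⟨j, x, hx⟩ := exists_rep_of_isColimit b hι hd (toElement f)
      refine ⟨j, ofElement x, toElement_injective ?_⟩
      refine hx.symm.trans (Eq.trans ?_ (toElement_comp _ _).symm)
      rw [toElement_ofElement]
    · have h0 : (d.ι.app i).lin (toElement f - toElement g) = 0 := by
        rw [map_sub, sub_eq_zero]
        exact congrArg toElement h
      obtain ⟨k, φ, hk⟩ := exists_map_eq_zero_of_isColimit b hι hd _ h0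
      refine ⟨k, φ, toElement_injective ?_⟩
      rw [map_sub, sub_eq_zero] at hk
      exact hk⟩⟩⟩

end Contramodule

theorem exists_isCardinalPresentable_dual {K : Type u} [Field K] {X : Type u} [SmallCategory X]
    (𝒞 : X ⥤ CoalgCat.{u} K) : ∃ (κ : Cardinal.{u}) (_ : Fact κ.IsRegular),
      ∀ x : X, IsCardinalPresentable (Contramodule.dual K (𝒞.obj x)) κ := by
  obtain ⟨κ, hκ, h⟩ := HasCardinalLT.exists_regular_cardinal_forall.{u}
    fun x : X => Module.Basis.ofVectorSpaceIndex K (𝒞.obj x)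
  exact ⟨κ, ⟨hκ⟩, fun x => @Contramodule.isCardinalPresentable_dual _ _ _ _ _ _ κ ⟨hκ⟩ _
    (Module.Basis.ofVectorSpace K (𝒞.obj x)) (h x)⟩

/-! ### The universal property of contraextension -/

namespace Contramodule

variable {K : Type u} [Field K]
variable {C : Type u} [AddCommGroup C] [Module K C] [Coalgebra K C]
variable {D : Type u} [AddCommGroup D] [Module K D] [Coalgebra K D]

theorem unit_π_sub_mem (α : C →ₗc[K] D) (N : Contramodule K D) (f : D →ₗ[K] N.carrier) :
    unit C _ (N.π f) - f ∘ₗ α.toLinearMap ∈ LinearMap.range (cohomRel α N) := by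
  -- The witness is `c ↦ ε(c) f`: contracting its values gives the unit at `N.π f`, and the coaction
  -- term collapses to `f ∘ α` by the counit law.
  refine ⟨unit C _ f, ?_⟩
  have h : LinearMap.lcomp K N.carrier α.toLinearMap ∘ₗ unit C _ f =
      unit C _ (f ∘ₗ α.toLinearMap) := comp_unit _ _
  rw [cohomRel_apply, comp_unit, lift_comp_rightCoaction, h]
  exact congrArg (unit C _ (N.π f) - ·) (π_unit (free K C N.carrier) _)

/-- The canonical map `N → α^• N`. -/
noncomputable def contraextensionUnit (α : C →ₗc[K] D) (N : Contramodule K D) :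
    N.carrier →ₗ[K] (contraextensionObj α N).carrier :=
  (LinearMap.range (cohomRel α N)).mkQ ∘ₗ unit C N.carrier

theorem contraextensionUnit_π (α : C →ₗc[K] D) (N : Contramodule K D) (f : D →ₗ[K] N.carrier) :
    contraextensionUnit α N (N.π f) =
      (contraextensionObj α N).π (contraextensionUnit α N ∘ₗ f ∘ₗ α.toLinearMap) := by
  refine Eq.trans ?_ (contraextensionObj_π_mkQ α N (unit C _ ∘ₗ f ∘ₗ α.toLinearMap)).symm
  rw [freeπ_unit_comp]
  exact (Submodule.Quotient.eq _).2 (unit_π_sub_mem α N f)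

/-- The morphism `α^• N → M` that corresponds to a morphism `N → α_• M`. -/
noncomputable def contraextensionDesc (α : C →ₗc[K] D) {N : Contramodule K D}
    {M : Contramodule K C} (u : N ⟶ (contrarestriction α).obj M) :
    contraextensionObj α N ⟶ M :=
  quotientDesc _ _ (range_cohomRel_closed α N) (freeDesc (N := M) (V := N.carrier) u.lin) <| by
    rintro _ ⟨g, rfl⟩
    refine LinearMap.mem_ker.2 ?_
    -- Written as a contraction in the free contramodule, the coaction term is carried by `freeDesc`
    -- to a contraction in `M`. The two terms then agree because `u` is a morphism into `α_• M`.
    have h : cohomRel α N g = N.π ∘ₗ g -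
        freeπ C N.carrier (LinearMap.lcomp K N.carrier α.toLinearMap ∘ₗ g) := by
      rw [cohomRel_apply, lift_comp_rightCoaction]
    refine (congrArg (freeDesc (N := M) (V := N.carrier) u.lin).lin h).trans ?_
    refine (map_sub (freeDesc (N := M) (V := N.carrier) u.lin).lin _ _).trans (sub_eq_zero.2 ?_)
    refine Eq.trans ?_ ((freeDesc (N := M) (V := N.carrier) u.lin).comm _).symm
    exact congrArg M.π (LinearMap.ext fun c => u.comm (g c))

theorem contraextensionDesc_unit (α : C →ₗc[K] D) {N : Contramodule K D}
    {M : Contramodule K C} (u : N ⟶ (contrarestriction α).obj M) (n : N.carrier) :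
    (contraextensionDesc α u).lin (contraextensionUnit α N n) = u.lin n :=
  freeDesc_unit (N := M) (V := N.carrier) u.lin n

theorem contraextension_hom_ext (α : C →ₗc[K] D) {N : Contramodule K D}
    {M : Contramodule K C} {φ ψ : contraextensionObj α N ⟶ M}
    (h : ∀ n, φ.lin (contraextensionUnit α N n) = ψ.lin (contraextensionUnit α N n)) : φ = ψ := by
  have key : quotientMk (free K C N.carrier) _ (range_cohomRel_closed α N) ≫ φ =
      quotientMk (free K C N.carrier) _ (range_cohomRel_closed α N) ≫ ψ := free_hom_ext h
  exact hom_ext (Submodule.linearMap_qext (LinearMap.range (cohomRel α N))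
    (congrArg Hom.lin key))

end Contramodule

/-! ### Componentwise colimits of trans-contramodules -/

namespace TransContramodule

section

variable {K : Type u} [Field K] {X : Type u} [SmallCategory X] {𝒞 : X ⥤ CoalgCat.{u} K}

theorem hom_ext {M N : TransContramodule 𝒞} {f g : M ⟶ N}
    (h : ∀ x m, (f.app x).lin m = (g.app x).lin m) : f = g :=
  Hom.ext (funext fun x => Contramodule.hom_ext (LinearMap.ext (h x)))

theorem app_map {M N : TransContramodule 𝒞} (f : M ⟶ N) {x y : X} (α : x ⟶ y)
    (m : (M.obj y).carrier) :
    (f.app x).lin ((M.map α).lin m) = (N.map α).lin ((f.app y).lin m) :=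
  LinearMap.congr_fun (congrArg Contramodule.Hom.lin (f.naturality α)) m

theorem map_π (M : TransContramodule 𝒞) {x y : X} (α : x ⟶ y)
    (f : 𝒞.obj y →ₗ[K] (M.obj y).carrier) :
    (M.map α).lin ((M.obj y).π f) =
      (M.obj x).π ((M.map α).lin ∘ₗ f ∘ₗ (𝒞.map α).toCoalgHom.toLinearMap) :=
  (M.map α).comm f

theorem toLinearMap_map_id (𝒞 : X ⥤ CoalgCat.{u} K) (x : X) :
    (𝒞.map (𝟙 x)).toCoalgHom.toLinearMap = LinearMap.id := by
  rw [CategoryTheory.Functor.map_id]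
  rfl

theorem toLinearMap_map_comp (𝒞 : X ⥤ CoalgCat.{u} K) {x y z : X} (α : x ⟶ y) (β : y ⟶ z) :
    (𝒞.map (α ≫ β)).toCoalgHom.toLinearMap =
      (𝒞.map β).toCoalgHom.toLinearMap ∘ₗ (𝒞.map α).toCoalgHom.toLinearMap := by
  rw [CategoryTheory.Functor.map_comp]
  rfl

variable (𝒞) in
/-- The functor that takes a trans-contramodule to its component at an object. -/
def eval (x : X) : TransContramodule 𝒞 ⥤ Contramodule K (𝒞.obj x) where
  obj M := M.obj x
  map f := f.app x

section Colimits

variable {J : Type u} [SmallCategory J] (F : J ⥤ TransContramodule 𝒞)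

/-- The cocone that defines a structure morphism of a colimit of trans-contramodules. -/
noncomputable def colimitMapCocone {x y : X} (α : x ⟶ y) : Cocone (F ⋙ eval 𝒞 y) where
  pt := (Contramodule.contrarestriction (𝒞.map α).toCoalgHom).obj (colimit (F ⋙ eval 𝒞 x))
  ι :=
    { app j := (F.obj j).map α ≫ (Contramodule.contrarestriction (𝒞.map α).toCoalgHom).map
        (colimit.ι (F ⋙ eval 𝒞 x) j)
      naturality _ j φ := by
        refine Contramodule.hom_ext (LinearMap.ext fun m => ?_)
        refine (congrArg (colimit.ι (F ⋙ eval 𝒞 x) j).lin (app_map (F.map φ) α m).symm).trans ?_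
        exact Contramodule.app_map_lin (colimit.cocone (F ⋙ eval 𝒞 x)) φ _ }

/-- The structure morphisms of a colimit of trans-contramodules. -/
noncomputable def colimitMap {x y : X} (α : x ⟶ y) : colimit (F ⋙ eval 𝒞 y) ⟶
    (Contramodule.contrarestriction (𝒞.map α).toCoalgHom).obj (colimit (F ⋙ eval 𝒞 x)) :=
  colimit.desc (F ⋙ eval 𝒞 y) (colimitMapCocone F α)

theorem colimitMap_ι {x y : X} (α : x ⟶ y) (j : J) (m : ((F.obj j).obj y).carrier) :
    (colimitMap F α).lin ((colimit.ι (F ⋙ eval 𝒞 y) j).lin m) =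
      (colimit.ι (F ⋙ eval 𝒞 x) j).lin (((F.obj j).map α).lin m) :=
  LinearMap.congr_fun (congrArg Contramodule.Hom.lin (colimit.ι_desc (colimitMapCocone F α) j)) m

/-- The colimit of a diagram of trans-contramodules, computed componentwise. -/
noncomputable def colimitObj : TransContramodule 𝒞 where
  obj x := colimit (F ⋙ eval 𝒞 x)
  map α := colimitMap F α
  map_id x m := by
    -- The contrarestriction along `𝒞.map (𝟙 x)` is not definitionally the original contramodule, so
    -- the comparison with the identity is made between linear maps.
    refine LinearMap.congr_fun (g := LinearMap.id) (Contramodule.lin_ext_of_isColimit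
      (colimit.isColimit (F ⋙ eval 𝒞 x)) _ (colimitMap F (𝟙 x)).comm (fun f => ?_)
      fun j m => ?_) m
    · refine congrArg (colimit (F ⋙ eval 𝒞 x)).π ?_
      change f = f ∘ₗ (𝒞.map (𝟙 x)).toCoalgHom.toLinearMap
      rw [toLinearMap_map_id]
      rfl
    · refine (colimitMap_ι F (𝟙 x) j m).trans ?_
      exact congrArg (colimit.ι (F ⋙ eval 𝒞 x) j).lin ((F.obj j).map_id x m)
  map_comp {x y z} α β m := by
    refine LinearMap.congr_fun (g := (colimitMap F α).lin ∘ₗ (colimitMap F β).lin)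
      (Contramodule.lin_ext_of_isColimit
        (colimit.isColimit (F ⋙ eval 𝒞 z)) _ (colimitMap F (α ≫ β)).comm (fun f => ?_)
        fun j m => ?_) m
    · refine (congrArg (colimitMap F α).lin ((colimitMap F β).comm f)).trans ?_
      refine ((colimitMap F α).comm _).trans (congrArg (colimit (F ⋙ eval 𝒞 x)).π ?_)
      refine LinearMap.ext fun c => ?_
      refine congrArg (fun t => (colimitMap F α).lin ((colimitMap F β).lin (f t))) ?_
      exact (LinearMap.congr_fun (toLinearMap_map_comp 𝒞 α β) c).symm
    · refine (colimitMap_ι F (α ≫ β) j m).trans ?_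
      refine (congrArg (colimit.ι (F ⋙ eval 𝒞 x) j).lin ((F.obj j).map_comp α β m)).trans ?_
      exact ((congrArg (colimitMap F α).lin (colimitMap_ι F β j m)).trans
        (colimitMap_ι F α j _)).symm

/-- The colimit cocone of a diagram of trans-contramodules, computed componentwise. -/
noncomputable def colimitCocone : Cocone F where
  pt := colimitObj F
  ι :=
    { app j :=
        { app x := colimit.ι (F ⋙ eval 𝒞 x) j
          naturality α := Contramodule.hom_ext (LinearMap.ext fun m => (colimitMap_ι F α j m).symm) }
      naturality _ _ φ := hom_ext fun x m =>
        Contramodule.app_map_lin (colimit.cocone (F ⋙ eval 𝒞 x)) φ m }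

theorem colimit_desc_lin_ι (s : Cocone F) (x : X) (j : J) (m : ((F.obj j).obj x).carrier) :
    (colimit.desc (F ⋙ eval 𝒞 x) ((eval 𝒞 x).mapCocone s)).lin
      ((colimit.ι (F ⋙ eval 𝒞 x) j).lin m) = ((s.ι.app j).app x).lin m :=
  LinearMap.congr_fun (congrArg Contramodule.Hom.lin
    (colimit.ι_desc ((eval 𝒞 x).mapCocone s) j)) m

/-- The componentwise colimit cocone is a colimit. -/
noncomputable def isColimitColimitCocone : IsColimit (colimitCocone F) where
  desc s :=
    { app x := colimit.desc (F ⋙ eval 𝒞 x) ((eval 𝒞 x).mapCocone s)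
      naturality {x y} α := by
        refine colimit.hom_ext fun j => Contramodule.hom_ext (LinearMap.ext fun m => ?_)
        refine (congrArg (colimit.desc (F ⋙ eval 𝒞 x) ((eval 𝒞 x).mapCocone s)).lin
          (colimitMap_ι F α j m)).trans ?_
        refine (colimit_desc_lin_ι F s x j _).trans ((app_map (s.ι.app j) α m).trans ?_)
        exact congrArg (s.pt.map α).lin (colimit_desc_lin_ι F s y j m).symm }
  fac s j := hom_ext fun x m => colimit_desc_lin_ι F s x j m
  uniq s φ hφ := Hom.ext (funext fun x => colimit.hom_ext fun j =>
    (congrArg (fun t => t.app x) (hφ j)).trans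
      (colimit.ι_desc ((eval 𝒞 x).mapCocone s) j).symm)

instance : HasColimitsOfSize.{u, u} (TransContramodule 𝒞) where
  has_colimits_of_shape _ _ := ⟨fun F => ⟨⟨⟨_, isColimitColimitCocone F⟩⟩⟩⟩

instance (x : X) : PreservesColimitsOfSize.{u, u} (eval 𝒞 x) where
  preservesColimitsOfShape := ⟨fun {F} =>
    preservesColimit_of_preserves_colimit_cocone (isColimitColimitCocone F)
      ((colimit.isColimit (F ⋙ eval 𝒞 x)).ofIsoColimit (Cocone.ext (Iso.refl _)))⟩

end Colimits

end

/-! ### The adjunction between `ex_x` and evaluation at `x` -/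

section Extension

variable {K : Type u} [Field K] {X : Type u} [PartialOrder X] (𝒞 : X ⥤ CoalgCat.{u} K) (x : X)

/-- The canonical morphism `N → ex_x(N)_x`. -/
noncomputable def exUnit (N : Contramodule K (𝒞.obj x)) : N ⟶ (exObj 𝒞 x N).obj x where
  lin := LinearMap.pi fun α : x ⟶ x =>
    Contramodule.contraextensionUnit (𝒞.map α).toCoalgHom N
  comm f := funext fun α => by
    obtain rfl : α = 𝟙 x := Subsingleton.elim _ _
    refine (Contramodule.contraextensionUnit_π _ N f).trans ?_
    rw [toLinearMap_map_id]
    rfl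

theorem map_exUnit (N : Contramodule K (𝒞.obj x)) {y : X} (α : y ⟶ x) (n : N.carrier) :
    ((exObj 𝒞 x N).map α).lin ((exUnit 𝒞 x N).lin n) =
      fun β : y ⟶ x => Contramodule.contraextensionUnit (𝒞.map β).toCoalgHom N n := by
  funext β
  refine (exComponent_lin 𝒞 x N α β (𝟙 x) _).trans ?_
  refine congrArg (Submodule.mkQ _) (LinearMap.ext fun c => ?_)
  simp [Contramodule.unit_apply]

variable {𝒞 x}

/-- For `α : y ⟶ x` the component at `y` is `α^• N`, generated by the image of `N`. By `map_exUnit`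
this image comes from the component at `x`, so naturality determines the morphism. -/
theorem ex_hom_ext {N : Contramodule K (𝒞.obj x)} {M : TransContramodule 𝒞}
    {f g : exObj 𝒞 x N ⟶ M}
    (h : ∀ n, (f.app x).lin ((exUnit 𝒞 x N).lin n) = (g.app x).lin ((exUnit 𝒞 x N).lin n)) :
    f = g := by
  refine Hom.ext (funext fun y => ?_)
  by_cases hy : y ≤ x
  · let ι : Contramodule.contraextensionObj (𝒞.map (homOfLE hy)).toCoalgHom N ⟶
        (exObj 𝒞 x N).obj y :=
      { lin := LinearMap.pi fun β => by
          exact (Subsingleton.elim (homOfLE hy) β) ▸ LinearMap.id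
        comm f := funext fun β => by
          obtain rfl : homOfLE hy = β := Subsingleton.elim _ _
          rfl }
    have key : ι ≫ f.app y = ι ≫ g.app y := by
      refine Contramodule.contraextension_hom_ext _ fun n => ?_
      have hn : ι.lin (Contramodule.contraextensionUnit (𝒞.map (homOfLE hy)).toCoalgHom N n) =
          ((exObj 𝒞 x N).map (homOfLE hy)).lin ((exUnit 𝒞 x N).lin n) := by
        rw [map_exUnit]
        funext β
        obtain rfl : homOfLE hy = β := Subsingleton.elim _ _
        rfl
      refine (congrArg (f.app y).lin hn).trans (Eq.trans ?_ (congrArg (g.app y).lin hn).symm)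
      rw [app_map, app_map, h]
    refine Contramodule.hom_ext (LinearMap.ext fun m => ?_)
    have hm : m = ι.lin (m (homOfLE hy)) := by
      funext β
      obtain rfl : homOfLE hy = β := Subsingleton.elim _ _
      rfl
    rw [hm]
    exact LinearMap.congr_fun (congrArg Contramodule.Hom.lin key) _
  · refine Contramodule.hom_ext (LinearMap.ext fun m => ?_)
    obtain rfl : m = 0 := @Subsingleton.elim _ (exValue_subsingleton 𝒞 x N hy) _ _
    rw [map_zero, map_zero]

open Classical in
/-- The components of the morphism `ex_x(N) → M` that corresponds to a morphism `N → M_x`. -/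
noncomputable def exDescApp {N : Contramodule K (𝒞.obj x)} {M : TransContramodule 𝒞}
    (u : N ⟶ M.obj x) (y : X) : exValue 𝒞 x N y ⟶ M.obj y :=
  if h : y ≤ x then
    Contramodule.proj _ (homOfLE h) ≫
      Contramodule.contraextensionDesc (𝒞.map (homOfLE h)).toCoalgHom (u ≫ M.map (homOfLE h))
  else Contramodule.zeroHom _ _

theorem exDescApp_lin {N : Contramodule K (𝒞.obj x)} {M : TransContramodule 𝒞}
    (u : N ⟶ M.obj x) {y : X} (α : y ⟶ x) (m : (exValue 𝒞 x N y).carrier) :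
    (exDescApp u y).lin m =
      (Contramodule.contraextensionDesc (𝒞.map α).toCoalgHom (u ≫ M.map α)).lin (m α) := by
  have h : y ≤ x := leOfHom α
  obtain rfl : homOfLE h = α := Subsingleton.elim _ _
  have e : exDescApp u y = _ := dif_pos h
  rw [e]
  rfl

/-- The morphism `ex_x(N) → M` that corresponds to a morphism `N → M_x`. -/
noncomputable def exDesc {N : Contramodule K (𝒞.obj x)} {M : TransContramodule 𝒞}
    (u : N ⟶ M.obj x) : exObj 𝒞 x N ⟶ M where
  app y := exDescApp u y
  naturality {z y} β := by
    refine Contramodule.hom_ext (LinearMap.ext fun m => ?_)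
    change (exDescApp u z).lin (((exObj 𝒞 x N).map β).lin m) =
      (M.map β).lin ((exDescApp u y).lin m)
    by_cases h : y ≤ x
    · let α := homOfLE h
      refine (exDescApp_lin u (β ≫ α) _).trans (Eq.trans ?_
        (congrArg (M.map β).lin (exDescApp_lin u α m).symm))
      refine (congrArg _ (exComponent_lin 𝒞 x N β (β ≫ α) α m)).trans ?_
      -- On the class of `f` both sides are contractions in `M_z`, and their arguments agree by
      -- functoriality of `M`.
      obtain ⟨f, hf⟩ := Submodule.mkQ_surjective _ (m α)
      rw [← hf]
      refine Eq.trans ?_ (map_π M β _).symm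
      refine congrArg (M.obj z).π (LinearMap.ext fun c => ?_)
      exact M.map_comp β α _
    · obtain rfl : m = 0 := @Subsingleton.elim _ (exValue_subsingleton 𝒞 x N h) _ _
      refine (congrArg (exDescApp u z).lin (map_zero ((exObj 𝒞 x N).map β).lin)).trans ?_
      refine (map_zero (exDescApp u z).lin).trans ?_
      exact ((congrArg (M.map β).lin (map_zero (exDescApp u y).lin)).trans
        (map_zero (M.map β).lin)).symm

theorem exDesc_exUnit {N : Contramodule K (𝒞.obj x)} {M : TransContramodule 𝒞}
    (u : N ⟶ M.obj x) (n : N.carrier) :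
    ((exDesc u).app x).lin ((exUnit 𝒞 x N).lin n) = u.lin n := by
  refine (exDescApp_lin u (𝟙 x) _).trans ?_
  refine (Contramodule.contraextensionDesc_unit _ _ n).trans ?_
  exact M.map_id x _

variable (𝒞 x) in
/-- The functor `ex_x` is left adjoint to the evaluation at `x`. -/
noncomputable def exAdjunction : ex 𝒞 x ⊣ eval 𝒞 x :=
  Adjunction.mkOfHomEquiv
    { homEquiv N M :=
        { toFun f := exUnit 𝒞 x N ≫ f.app x
          invFun u := exDesc u
          left_inv f := ex_hom_ext fun n => exDesc_exUnit _ n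
          right_inv u := Contramodule.hom_ext (LinearMap.ext fun n => exDesc_exUnit u n) }
      homEquiv_naturality_left_symm {N N' M} u v := ex_hom_ext fun n => by
        refine (exDesc_exUnit _ n).trans ((exDesc_exUnit v (u.lin n)).symm.trans ?_)
        refine congrArg ((exDesc v).app x).lin (funext fun α => ?_)
        refine congrArg (Submodule.mkQ _) ?_
        exact (Contramodule.comp_unit u.lin n).symm
      homEquiv_naturality_right f g := rfl }

end Extension

end TransContramodule

/-! ### The abelian structure -/

namespace TransContramodule

section

variable {K : Type u} [Field K] {X : Type u} [SmallCategory X] {𝒞 : X ⥤ CoalgCat.{u} K}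

instance (M N : TransContramodule 𝒞) : Zero (M ⟶ N) where
  zero :=
    { app _ := Contramodule.zeroHom _ _
      naturality α := Contramodule.hom_ext (LinearMap.ext fun _ => (map_zero (N.map α).lin).symm) }

instance (M N : TransContramodule 𝒞) : Add (M ⟶ N) where
  add f g :=
    { app x :=
        { lin := (f.app x).lin + (g.app x).lin
          comm h := by
            rw [LinearMap.add_comp, map_add, ← (f.app x).comm, ← (g.app x).comm]
            rfl }
      naturality {x y} α := Contramodule.hom_ext <| LinearMap.ext fun m =>
        (congrArg₂ (· + ·) (app_map f α m) (app_map g α m)).trans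
          (map_add (N.map α).lin ((f.app y).lin m) ((g.app y).lin m)).symm }

instance (M N : TransContramodule 𝒞) : Neg (M ⟶ N) where
  neg f :=
    { app x :=
        { lin := -(f.app x).lin
          comm h := by
            rw [LinearMap.neg_comp, map_neg, ← (f.app x).comm]
            rfl }
      naturality {x y} α := Contramodule.hom_ext <| LinearMap.ext fun m =>
        (congrArg Neg.neg (app_map f α m)).trans
          (map_neg (N.map α).lin ((f.app y).lin m)).symm }

theorem zero_app_lin {M N : TransContramodule 𝒞} (x : X) (m : (M.obj x).carrier) :
    ((0 : M ⟶ N).app x).lin m = 0 := rfl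

theorem add_app_lin {M N : TransContramodule 𝒞} (f g : M ⟶ N) (x : X) (m : (M.obj x).carrier) :
    ((f + g).app x).lin m = (f.app x).lin m + (g.app x).lin m := rfl

theorem neg_app_lin {M N : TransContramodule 𝒞} (f : M ⟶ N) (x : X) (m : (M.obj x).carrier) :
    ((-f).app x).lin m = -(f.app x).lin m := rfl

instance (M N : TransContramodule 𝒞) : AddCommGroup (M ⟶ N) where
  __ := AddGroup.ofLeftAxioms (G := (M ⟶ N))
    (fun f g h => hom_ext fun x m => by simp only [add_app_lin, add_assoc])
    (fun f => hom_ext fun x m => by simp only [add_app_lin, zero_app_lin, zero_add])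
    (fun f => hom_ext fun x m => by
      simp only [add_app_lin, neg_app_lin, zero_app_lin, neg_add_cancel])
  add_comm f g := hom_ext fun x m => by
    refine (add_app_lin f g x m).trans (Eq.trans ?_ (add_app_lin g f x m).symm)
    exact add_comm _ _

instance : Preadditive (TransContramodule 𝒞) where
  add_comp _ _ _ _ _ h := hom_ext fun x _ => map_add (h.app x).lin _ _
  comp_add _ _ _ _ _ _ := hom_ext fun _ _ => rfl

/-- The lift is `t ∘ g` for linear retractions `t` of the components of `i`. These need not respect
contractions, but `i ∘ t ∘ g = g` and injectivity of `i` force `t ∘ g` to do so. -/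
theorem exists_lift_of_injective {A M Z : TransContramodule 𝒞} (i : A ⟶ M)
    (hi : ∀ x, Function.Injective (i.app x).lin) (g : Z ⟶ M)
    (hg : ∀ x z, ∃ a, (i.app x).lin a = (g.app x).lin z) : ∃ l : Z ⟶ A, l ≫ i = g := by
  choose t ht using fun x =>
    (i.app x).lin.exists_leftInverse_of_injective (LinearMap.ker_eq_bot.2 (hi x))
  have key (x : X) (z : (Z.obj x).carrier) :
      (i.app x).lin (t x ((g.app x).lin z)) = (g.app x).lin z := by
    obtain ⟨a, ha⟩ := hg x z
    rw [← ha]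
    exact congrArg _ (LinearMap.congr_fun (ht x) a)
  refine ⟨{ app x :=
              { lin := t x ∘ₗ (g.app x).lin
                comm f := hi x ?_ }
            naturality {x y} α :=
              Contramodule.hom_ext (LinearMap.ext fun z => hi x ?_) },
    hom_ext fun x z => key x z⟩
  · refine (key x _).trans (((g.app x).comm f).trans (Eq.trans ?_ ((i.app x).comm _).symm))
    exact congrArg (M.obj x).π (LinearMap.ext fun c => (key x (f c)).symm)
  · refine (key x _).trans ((app_map g α z).trans (Eq.trans ?_ (app_map i α _).symm))
    exact congrArg (M.map α).lin (key y z).symm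

/-- The descent is `g ∘ s` for linear sections `s` of the components of `p`. It is a morphism
because `g` kills the kernel of `p`, which makes the choice of preimage irrelevant. -/
theorem exists_desc_of_surjective {M Q Z : TransContramodule 𝒞} (p : M ⟶ Q)
    (hp : ∀ x, Function.Surjective (p.app x).lin) (g : M ⟶ Z)
    (hg : ∀ x m, (p.app x).lin m = 0 → (g.app x).lin m = 0) : ∃ l : Q ⟶ Z, p ≫ l = g := by
  choose s hs using fun x =>
    (p.app x).lin.exists_rightInverse_of_surjective (LinearMap.range_eq_top.2 (hp x))
  have hs' (x : X) (q : (Q.obj x).carrier) : (p.app x).lin (s x q) = q :=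
    LinearMap.congr_fun (hs x) q
  have key (x : X) (m : (M.obj x).carrier) :
      (g.app x).lin (s x ((p.app x).lin m)) = (g.app x).lin m := by
    rw [← sub_eq_zero, ← map_sub]
    apply hg
    rw [map_sub, hs', sub_self]
  refine ⟨{ app x :=
              { lin := (g.app x).lin ∘ₗ s x
                comm f := ?_ }
            naturality {x y} α := Contramodule.hom_ext (LinearMap.ext fun q => ?_) },
    hom_ext fun x m => key x m⟩
  · have hf : f = (p.app x).lin ∘ₗ (s x ∘ₗ f) := LinearMap.ext fun c => (hs' x (f c)).symm
    refine Eq.trans ?_ ((g.app x).comm (s x ∘ₗ f))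
    refine Eq.trans ?_ (key x _)
    exact congrArg (fun t => (g.app x).lin (s x t))
      ((congrArg (Q.obj x).π hf).trans ((p.app x).comm _).symm)
  · obtain ⟨m, rfl⟩ := hp y q
    refine (congrArg (fun t => (g.app x).lin (s x t)) (app_map p α m).symm).trans ?_
    refine (key x _).trans ((app_map g α m).trans ?_)
    exact congrArg (Z.map α).lin (key y m).symm

/-- A family of subcontramodules that is stable under the structure morphisms. -/
structure Sub (M : TransContramodule 𝒞) where
  toSubmodule (x : X) : Submodule K (M.obj x).carrier
  isClosed (x : X) : (M.obj x).IsClosed (toSubmodule x)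
  map_mem {x y : X} (α : x ⟶ y) (m : (M.obj y).carrier) (hm : m ∈ toSubmodule y) :
    (M.map α).lin m ∈ toSubmodule x

/-- The trans-contramodule structure on a sub-trans-contramodule. -/
noncomputable def Sub.obj {M : TransContramodule 𝒞} (R : Sub M) : TransContramodule 𝒞 where
  obj x := (M.obj x).sub (R.toSubmodule x) (R.isClosed x)
  map {_ y} α :=
    { lin := (M.map α).lin.restrict (R.map_mem α)
      comm f := Subtype.ext <|
        (M.map α).comm ((R.toSubmodule y).subtype ∘ₗ f) }
  map_id x m := Subtype.ext (M.map_id x m.1)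
  map_comp α β m := Subtype.ext (M.map_comp α β m.1)

/-- The inclusion of a sub-trans-contramodule. -/
noncomputable def Sub.ι {M : TransContramodule 𝒞} (R : Sub M) : R.obj ⟶ M where
  app x :=
    { lin := (R.toSubmodule x).subtype
      comm _ := rfl }
  naturality _ := rfl

/-- The quotient by a sub-trans-contramodule. -/
noncomputable def Sub.quotient {M : TransContramodule 𝒞} (R : Sub M) : TransContramodule 𝒞 where
  obj x := (M.obj x).quotient (R.toSubmodule x) (R.isClosed x)
  map {x y} α := Contramodule.quotientDesc _ _ _
    (M.map α ≫ (Contramodule.contrarestriction (𝒞.map α).toCoalgHom).map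
      (Contramodule.quotientMk _ _ (R.isClosed x)))
    fun m hm => (Submodule.Quotient.mk_eq_zero (R.toSubmodule x)).2 (R.map_mem α m hm)
  map_id x m := by
    obtain ⟨m, rfl⟩ := Submodule.mkQ_surjective (R.toSubmodule x) m
    exact congrArg (R.toSubmodule x).mkQ (M.map_id x m)
  map_comp {x y z} α β m := by
    obtain ⟨m, rfl⟩ := Submodule.mkQ_surjective (R.toSubmodule z) m
    exact congrArg (R.toSubmodule x).mkQ (M.map_comp α β m)

/-- The projection to the quotient by a sub-trans-contramodule. -/
noncomputable def Sub.π {M : TransContramodule 𝒞} (R : Sub M) : M ⟶ R.quotient where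
  app x := Contramodule.quotientMk _ _ (R.isClosed x)
  naturality _ := rfl

/-- The kernel of a morphism, as a sub-trans-contramodule. -/
def kernelSub {M N : TransContramodule 𝒞} (f : M ⟶ N) : Sub M where
  toSubmodule x := LinearMap.ker (f.app x).lin
  isClosed x := Contramodule.ker_isClosed (N.obj x).π _ (f.app x).comm
  map_mem α m hm :=
    (app_map f α m).trans ((congrArg (N.map α).lin hm).trans (map_zero (N.map α).lin))

/-- The range of a morphism, as a sub-trans-contramodule. -/
def rangeSub {M N : TransContramodule 𝒞} (f : M ⟶ N) : Sub N where
  toSubmodule x := LinearMap.range (f.app x).lin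
  isClosed x := Contramodule.range_isClosed (f.app x)
  map_mem α := by
    rintro _ ⟨m, rfl⟩
    exact ⟨_, app_map f α m⟩

/-- The componentwise kernel is an object of the category, so its inclusion must vanish. -/
theorem injective_of_mono {M N : TransContramodule 𝒞} (f : M ⟶ N) [Mono f] (x : X) :
    Function.Injective (f.app x).lin := by
  rw [injective_iff_map_eq_zero]
  intro m hm
  have h : (kernelSub f).ι = 0 := by
    rw [← cancel_mono f, zero_comp]
    exact hom_ext fun x m => m.2
  exact congrArg (fun t => (t.app x).lin ⟨m, hm⟩) h

theorem mono_of_injective {M N : TransContramodule 𝒞} (f : M ⟶ N)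
    (hf : ∀ x, Function.Injective (f.app x).lin) : Mono f where
  right_cancellation _ _ e := hom_ext fun x z => hf x (congrArg (fun t => (t.app x).lin z) e)

/-- The componentwise range is a subobject, and the projection to its quotient must vanish. -/
theorem surjective_of_epi {M N : TransContramodule 𝒞} (f : M ⟶ N) [Epi f] (x : X) :
    Function.Surjective (f.app x).lin := by
  have h : (rangeSub f).π = 0 := by
    rw [← cancel_epi f, comp_zero]
    exact hom_ext fun x m => (Submodule.Quotient.mk_eq_zero _).2 ⟨m, rfl⟩
  intro n
  exact (Submodule.Quotient.mk_eq_zero ((rangeSub f).toSubmodule x)).1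
    (congrArg (fun t => (t.app x).lin n) h)

theorem epi_of_surjective {M N : TransContramodule 𝒞} (f : M ⟶ N)
    (hf : ∀ x, Function.Surjective (f.app x).lin) : Epi f where
  left_cancellation _ _ e := hom_ext fun x n => by
    obtain ⟨m, rfl⟩ := hf x n
    exact congrArg (fun t => (t.app x).lin m) e

theorem isIso_of_mono_of_surjective {M N : TransContramodule 𝒞} (f : M ⟶ N) [Mono f]
    (hf : ∀ x, Function.Surjective (f.app x).lin) : IsIso f := by
  obtain ⟨l, hl⟩ := exists_lift_of_injective f (injective_of_mono f) (𝟙 N) fun x z => hf x z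
  exact ⟨l, by rw [← cancel_mono f, Category.assoc, hl, Category.comp_id, Category.id_comp], hl⟩

theorem nonempty_isLimit_kernelFork {A M N : TransContramodule 𝒞} (i : A ⟶ M) (f : M ⟶ N)
    (w : i ≫ f = 0) (hi : ∀ x, Function.Injective (i.app x).lin)
    (h : ∀ x m, (f.app x).lin m = 0 → ∃ a, (i.app x).lin a = m) :
    Nonempty (IsLimit (KernelFork.ofι i w)) :=
  have := mono_of_injective i hi
  ⟨KernelFork.IsLimit.ofι' i w fun g hg =>
    have hl := exists_lift_of_injective i hi g fun x z =>
      h x _ (congrArg (fun t => (t.app x).lin z) hg)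
    ⟨hl.choose, hl.choose_spec⟩⟩

theorem nonempty_isColimit_cokernelCofork {M N Q : TransContramodule 𝒞} (f : M ⟶ N) (p : N ⟶ Q)
    (w : f ≫ p = 0) (hp : ∀ x, Function.Surjective (p.app x).lin)
    (h : ∀ x n, (p.app x).lin n = 0 → ∃ m, (f.app x).lin m = n) :
    Nonempty (IsColimit (CokernelCofork.ofπ p w)) :=
  have := epi_of_surjective p hp
  ⟨CokernelCofork.IsColimit.ofπ' p w fun g hg =>
    have hl := exists_desc_of_surjective p hp g fun x n hn => by
      obtain ⟨m, rfl⟩ := h x n hn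
      exact congrArg (fun t => (t.app x).lin m) hg
    ⟨hl.choose, hl.choose_spec⟩⟩

theorem kernelSub_ι_comp {M N : TransContramodule 𝒞} (f : M ⟶ N) : (kernelSub f).ι ≫ f = 0 :=
  hom_ext fun _ m => m.2

theorem comp_rangeSub_π {M N : TransContramodule 𝒞} (f : M ⟶ N) : f ≫ (rangeSub f).π = 0 :=
  hom_ext fun _ m => (Submodule.Quotient.mk_eq_zero _).2 ⟨m, rfl⟩

instance : HasKernels (TransContramodule 𝒞) where
  has_limit f := by
    obtain ⟨h⟩ := nonempty_isLimit_kernelFork _ f (kernelSub_ι_comp f)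
      (fun _ => Subtype.val_injective) fun _ m hm => ⟨⟨m, hm⟩, rfl⟩
    exact ⟨⟨_, h⟩⟩

instance : IsNormalMonoCategory (TransContramodule 𝒞) where
  normalMonoOfMono f _ := by
    obtain ⟨h⟩ := nonempty_isLimit_kernelFork f _ (comp_rangeSub_π f) (injective_of_mono f)
      fun _ _ hm => (Submodule.Quotient.mk_eq_zero _).1 hm
    exact ⟨⟨_, _, _, h⟩⟩

instance : IsNormalEpiCategory (TransContramodule 𝒞) where
  normalEpiOfEpi f _ := by
    obtain ⟨h⟩ := nonempty_isColimit_cokernelCofork _ f (kernelSub_ι_comp f)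
      (surjective_of_epi f) fun _ m hm => ⟨⟨m, hm⟩, rfl⟩
    exact ⟨⟨_, _, _, h⟩⟩

/-- Trans-contramodules form an abelian category. -/
noncomputable instance : Abelian (TransContramodule 𝒞) where
  has_finite_products :=
    -- In a preadditive category finite coproducts are biproducts, so finite products come from the
    -- colimits already constructed.
    have := HasFiniteBiproducts.of_hasFiniteCoproducts (C := TransContramodule 𝒞)
    inferInstance

end

/-! ### Projective generators and local presentability -/

section Generators

variable {K : Type u} [Field K] {X : Type u} [PartialOrder X] {𝒞 : X ⥤ CoalgCat.{u} K} {x : X}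

/-- The morphism `ex_x(C_x^*) → M` that corresponds to an element of `M_x`. -/
noncomputable def exOfElement {M : TransContramodule 𝒞} (m : (M.obj x).carrier) :
    (ex 𝒞 x).obj (Contramodule.dual K (𝒞.obj x)) ⟶ M :=
  exDesc (Contramodule.ofElement m)

/-- The element of `M_x` that corresponds to a morphism `ex_x(C_x^*) → M`. -/
noncomputable def exToElement {M : TransContramodule 𝒞}
    (f : (ex 𝒞 x).obj (Contramodule.dual K (𝒞.obj x)) ⟶ M) : (M.obj x).carrier :=
  Contramodule.toElement (exUnit 𝒞 x _ ≫ f.app x)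

theorem exToElement_exOfElement {M : TransContramodule 𝒞} (m : (M.obj x).carrier) :
    exToElement (exOfElement m) = m :=
  (exDesc_exUnit _ _).trans (Contramodule.toElement_ofElement m)

theorem exToElement_comp {M N : TransContramodule 𝒞}
    (f : (ex 𝒞 x).obj (Contramodule.dual K (𝒞.obj x)) ⟶ M) (g : M ⟶ N) :
    exToElement (f ≫ g) = (g.app x).lin (exToElement f) := rfl

theorem exToElement_injective {M : TransContramodule 𝒞}
    {f g : (ex 𝒞 x).obj (Contramodule.dual K (𝒞.obj x)) ⟶ M}
    (h : exToElement f = exToElement g) : f = g :=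
  ex_hom_ext fun n =>
    LinearMap.congr_fun (congrArg Contramodule.Hom.lin (Contramodule.toElement_injective h)) n

/-- Factoring a morphism through `e` means lifting one element along the component of `e` at `x`,
which is surjective. -/
theorem projective_ex_dual (x : X) :
    Projective ((ex 𝒞 x).obj (Contramodule.dual K (𝒞.obj x))) where
  factors f e _ := by
    obtain ⟨m, hm⟩ := surjective_of_epi e x (exToElement f)
    refine ⟨exOfElement m, exToElement_injective ?_⟩
    rw [exToElement_comp, exToElement_exOfElement, hm]

theorem isStrongGenerator_ex_dual (𝒞 : X ⥤ CoalgCat.{u} K) :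
    (ObjectProperty.ofObj fun x : X =>
      (ex 𝒞 x).obj (Contramodule.dual K (𝒞.obj x))).IsStrongGenerator := by
  rw [ObjectProperty.isStrongGenerator_iff]
  refine ⟨fun M N f g h => hom_ext fun x m => ?_, fun M N i _ h => ?_⟩
  · have := congrArg exToElement (h _ (ObjectProperty.ofObj_apply _ x) (exOfElement m))
    rwa [exToElement_comp, exToElement_comp, exToElement_exOfElement] at this
  -- The morphism classifying `n` factors through `i`, and the element of its factor is a preimage
  -- of `n`.
  · refine isIso_of_mono_of_surjective i fun x n => ?_
    obtain ⟨f, hf⟩ := h _ (ObjectProperty.ofObj_apply _ x) (exOfElement n)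
    refine ⟨exToElement f, ?_⟩
    rw [← exToElement_comp]
    exact (congrArg exToElement hf).trans (exToElement_exOfElement n)

/-- The right adjoint, evaluation at `x`, preserves all small colimits, in particular the
`κ`-filtered ones. -/
theorem isCardinalPresentable_ex_obj (N : Contramodule K (𝒞.obj x)) (κ : Cardinal.{u})
    [Fact κ.IsRegular] [IsCardinalPresentable N κ] :
    IsCardinalPresentable ((ex 𝒞 x).obj N) κ :=
  (exAdjunction 𝒞 x).isCardinalPresentable_leftAdjoint_obj κ N

theorem isCardinalLocallyPresentable (𝒞 : X ⥤ CoalgCat.{u} K) (κ : Cardinal.{u})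
    [Fact κ.IsRegular] (h : ∀ x : X, IsCardinalPresentable (Contramodule.dual K (𝒞.obj x)) κ) :
    IsCardinalLocallyPresentable (TransContramodule 𝒞) κ := by
  rw [IsCardinalLocallyPresentable.iff_exists_isStrongGenerator]
  refine ⟨_, inferInstance, isStrongGenerator_ex_dual 𝒞, ?_⟩
  rintro _ ⟨x⟩
  have := h x
  exact isCardinalPresentable_ex_obj _ κ

end Generators

end TransContramodule

theorem mainTheorem8 {K : Type u} [Field K] {X : Type u} [PartialOrder X]
    (𝒞 : X ⥤ CoalgCat.{u} K) :
    Nonempty (Abelian (TransContramodule 𝒞)) ∧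
    IsLocallyPresentable.{u} (TransContramodule 𝒞) ∧
    (ObjectProperty.ofObj fun x : X =>
      (TransContramodule.ex 𝒞 x).obj (Contramodule.dual K (𝒞.obj x))).IsStrongGenerator ∧
    (∀ x : X, Projective ((TransContramodule.ex 𝒞 x).obj (Contramodule.dual K (𝒞.obj x)))) ∧
    (∃ (κ : Cardinal.{u}) (_ : Fact κ.IsRegular),
      ∀ x : X, IsCardinalPresentable (Contramodule.dual K (𝒞.obj x)) κ) ∧
    (∀ (κ : Cardinal.{u}) [Fact κ.IsRegular],
      (∀ x : X, IsCardinalPresentable (Contramodule.dual K (𝒞.obj x)) κ) →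
        (∀ x : X, IsCardinalPresentable
          ((TransContramodule.ex 𝒞 x).obj (Contramodule.dual K (𝒞.obj x))) κ) ∧
        IsCardinalLocallyPresentable (TransContramodule 𝒞) κ) := by
  obtain ⟨κ, hκ, h⟩ := exists_isCardinalPresentable_dual 𝒞
  refine ⟨⟨inferInstance⟩,
    ⟨κ, hκ, TransContramodule.isCardinalLocallyPresentable 𝒞 κ h⟩,
    TransContramodule.isStrongGenerator_ex_dual 𝒞, TransContramodule.projective_ex_dual,
    ⟨κ, hκ, h⟩, fun κ' _ h' => ⟨fun x => ?_,
      TransContramodule.isCardinalLocallyPresentable 𝒞 κ' h'⟩⟩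
  have := h' x
  exact TransContramodule.isCardinalPresentable_ex_obj _ κ'
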